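/- Let $S$ be a countable set and let $p(\cdot,\cdot)$ be transition probabilities on $S$. Let $X=\langle X_m\rangle_{m\ge 0}$ and $Y=\langle Y_n\rangle_{n\ge 0}$ be independent transient Markov chains on $S$, both with transition probabilities $p$, and with possibly different initial states $x_0$ and $y_0$. (Transient means that almost surely each state is visited only finitely often.) For an infinite sequence $\gamma=\langle v_0,v_1,v_2,\dots\rangle$ in $S$ in which each state occurs only finitely often, the loop-erasure $\mathsf{LE}(\gamma)=\langle u_0,u_1,\dots\rangle$ is defined inductively by $u_0:=v_0$ and $u_{j+1}:=v_{k+1}$, where $k$ is the last index with $v_k=u_j$. We also write $\mathsf{LE}(\gamma)$ for the set $\{u_0,u_1,\dots\}$. Then the following hold. (1) $$\mathbf P\big[\mathsf{LE}\langle X_m\rangle_{m\ge 0}\cap\{Y_n\}_{n\ge 0}\neq\emptyset\big]\ \ge\ 2^{-8}\,\mathbf P\big[\{X_m\}_{m\ge 0}\cap\{Y_n\}_{n\ge 0}\neq\emptyset\big].$$ (2) For every $k\ge 0$ and all fixed $x_{-k},\dots,x_{-1}\in S$, setting $X_j:=x_j$ for $-k\le j\le -1$, $$\mathbf P\big[\mathsf{LE}\langle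 X_m\rangle_{m\ge -k}\cap\{Y_n\}_{n\ge 0}\neq\emptyset\big]\ \ge\ 2^{-8}\,\mathbf P\big[\exists\, m\ge 0\ \exists\, n\ge 0:\ X_m=Y_n\big].$$ (3) For every $k\ge 0$ and all $x_1,\dots,x_k\in S$ such that the event $B:=\{X_1=x_1,\dots,X_k=x_k\}$ has $\mathbf P[B]>0$, $$\mathbf P\big[\mathsf{LE}\langle X_m\rangle_{m\ge 0}\cap\{Y_n\}_{n\ge 0}\neq\emptyset\ \big|\ B\big]\ \ge\ 2^{-8}\,\mathbf P\big[\exists\, m\ge k\ \exists\, n\ge 0:\ X_m=Y_n\ \big|\ B\big].$$ -/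

import Mathlib

open MeasureTheory ProbabilityTheory
open scoped ENNReal

namespace LoopErasedWalk

/-- The last index `k` with `γ k = s`, for a state `s` which the sequence `γ` visits at least
once and only finitely often. (The value is not meaningful for other states.) -/
noncomputable def lastVisit {S : Type*} (γ : ℕ → S) (s : S) : ℕ :=
  sSup {k : ℕ | γ k = s}

/-- The loop-erasure `⟨u₀, u₁, …⟩` of an infinite sequence `γ` in which every state occurs only
finitely often: `u₀ = γ 0`, and `u_{j+1} = γ (k + 1)` where `k` is the last index with
`γ k = u_j`. -/
noncomputable def loopErasure {S : Type*} (γ : ℕ → S) : ℕ → S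
  | 0 => γ 0
  | j + 1 => γ (lastVisit γ (loopErasure γ j) + 1)

/-- The sequence `⟨x₋ₖ, …, x₋₁, γ 0, γ 1, …⟩` re-indexed from `0`, where `x₋ₖ, …, x₋₁` are the
entries `x 0, …, x (k - 1)`. -/
def withPrefix {S : Type*} {k : ℕ} (x : Fin k → S) (γ : ℕ → S) : ℕ → S :=
  fun i => if h : i < k then x ⟨i, h⟩ else γ (i - k)

/-- `X` is a time-homogeneous Markov chain under `μ` with transition probabilities `p` and
initial state `x₀`. The Markov property
`μ (X_{n+1} = s_{n+1} | X_0 = s_0, …, X_n = s_n) = p (s_n, s_{n+1})` is written in product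
form, so that it is also meaningful when the conditioning event is null. -/
structure IsMarkovChain {Ω S : Type*} [MeasurableSpace Ω] [MeasurableSpace S]
    (p : S → PMF S) (x₀ : S) (X : ℕ → Ω → S) (μ : Measure Ω) : Prop where
  measurable : ∀ n, Measurable (X n)
  initial : ∀ᵐ ω ∂μ, X 0 ω = x₀
  step : ∀ (n : ℕ) (s : ℕ → S),
    μ {ω | ∀ i ≤ n + 1, X i ω = s i} = μ {ω | ∀ i ≤ n, X i ω = s i} * p (s n) (s (n + 1))

/-- The chain `X` is transient: almost surely, each state is visited only finitely often. For a
Markov chain on a countable state space this says that every state which the chain reaches with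
positive probability is a transient state. -/
def IsTransient {Ω S : Type*} [MeasurableSpace Ω] (X : ℕ → Ω → S) (μ : Measure Ω) : Prop :=
  ∀ s : S, ∀ᵐ ω ∂μ, {n : ℕ | X n ω = s}.Finite

end LoopErasedWalk

/-!
The comparison is proved by the second moment method, applied to meetings of the two chains that
are weighted so that the second moment is controlled by the probability of a meeting.

Fix a time horizon `N` and let `(m, n)` be the first pair of times, in lexicographic order, at
which `X m = Y n`; let `e m n` be the indicator that this pair is `(m, n)`. The weights are
`W m n = E[e m n | X m, Y n]`, and `Z = ∑ W m n` has mean `P[H]`, where `H` is the event that the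
chains meet before the horizon. The main estimate is `E[Z²] ≤ 32 P[H]` (`second_moment_le`).
To see it, split the pairs of indices by their orders in the two time directions. If `m ≤ m'` and
`n ≤ n'`, then, as `e m n` depends on `X` only through its past up to `m`, the Markov property
turns `E[W m n * W m' n']` into `E[q m n * W m' n']` with
`q m n = E[e m n | X, Y 0, …, Y n]` (`pairSum_condPair_mul`). The sum `Q` of the `q m n` satisfies
`E[Q²] ≤ 2 P[H]` (`pairSum_sq_sum_condRight_le`): it is the projection of a process of total
variation at most `1` on the filtration of `Y`. So this part of `E[Z²]` is at most `E[Q * Z]`. The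
part with `n' ≤ n` is handled by the same argument for the time reversal of `Y`, which is again
Markov in the sense needed, and both are absorbed using `2xy ≤ x² + y²`. Since only finitely many
steps matter, this is done with sums over finite paths.

Now suppose that `X m = Y n`. Let `u` be the loop-erasure of `X` up to time `m` (with a
prefix, if any). The entries of `u` up to and including the first one which `X` visits at or after
time `m` belong to the loop-erasure of the whole path. So if `Y` after time `n` first
meets `u` no later than `X` after time `m` does, then `Y` meets the loop-erasure
(`loopErasure_inter_nonempty`). Given the pasts, the two futures are independent with the same
law, so by symmetry this good event has conditional probability at least `1/2`
(`measure_cell_le`). Hence the part of `Z` on the union `G` of the good events has mean at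
least `P[H] / 2`, and comparing with `E[Z²]` gives `P[H] ≤ 128 P[G]`.

The bound for an arbitrary prefix contains the one without prefix, and it also yields the
conditional bound: given the first `k` steps, `X` after time `k` is a chain with a fixed prefix.
-/

open MeasureTheory ProbabilityTheory
open scoped ENNReal

namespace LoopErasedWalk

/-! ### Averaging over the classes of a map -/

open Classical in
/-- The sum of `f` with weights `a` over the class of `i` under the map `T`. -/
noncomputable def classSum {α D : Type*} (a : α → ℝ≥0∞) (T : α → D) (f : α → ℝ≥0∞) (i : α) :
    ℝ≥0∞ :=
  ∑' j, if T j = T i then a j * f j else 0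

/-- The conditional expectation of `f` given `T`, for the measure with weights `a`. It vanishes
on classes without mass. -/
noncomputable def condAvg {α D : Type*} (a : α → ℝ≥0∞) (T : α → D) (f : α → ℝ≥0∞) (i : α) :
    ℝ≥0∞ :=
  classSum a T f i / classSum a T (fun _ => 1) i

section CondAvg

variable {α D : Type*} {a : α → ℝ≥0∞} {T : α → D}

lemma classSum_congr_class (f : α → ℝ≥0∞) {i i' : α} (h : T i = T i') :
    classSum a T f i = classSum a T f i' := by
  unfold classSum
  rw [h]

lemma condAvg_congr_class (f : α → ℝ≥0∞) {i i' : α} (h : T i = T i') :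
    condAvg a T f i = condAvg a T f i' := by
  simp only [condAvg, classSum_congr_class _ h]

lemma classSum_one_ne_top (ha : ∑' i, a i ≠ ∞) (i : α) :
    classSum a T (fun _ => 1) i ≠ ∞ := by
  refine ne_top_of_le_ne_top ha (ENNReal.tsum_le_tsum fun j => ?_)
  split_ifs <;> simp

lemma classSum_one_ne_zero {i : α} (hi : a i ≠ 0) : classSum a T (fun _ => 1) i ≠ 0 := by
  intro h
  have := ENNReal.tsum_eq_zero.1 h i
  simp [hi] at this

/-- Conditional expectation is self-adjoint. -/
lemma tsum_condAvg_mul (f g : α → ℝ≥0∞) :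
    ∑' i, a i * (condAvg a T f i * g i) = ∑' i, a i * (f i * condAvg a T g i) := by
  classical
  have key : ∀ f g : α → ℝ≥0∞, ∀ i, a i * (condAvg a T f i * g i) = ∑' j, if T j = T i then
      a i * a j * f j * g i * (classSum a T (fun _ => 1) i)⁻¹ else 0 := by
    intro f g i
    rw [condAvg, div_eq_mul_inv, classSum]
    rw [show ∀ s c : ℝ≥0∞, a i * (s * c * g i) = (a i * g i * c) * s from fun s c => by ring,
      ← ENNReal.tsum_mul_left]
    refine tsum_congr fun j => ?_
    split_ifs <;> ring
  simp_rw [key f g]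
  rw [ENNReal.tsum_comm]
  refine tsum_congr fun i => ?_
  rw [mul_comm (f i), key g f]
  refine tsum_congr fun j => ?_
  by_cases h : T j = T i
  · rw [if_pos h, if_pos h.symm, classSum_congr_class _ h]; ring
  · rw [if_neg h, if_neg (Ne.symm h)]

lemma condAvg_of_const_on_class (ha : ∑' i, a i ≠ ∞) {f : α → ℝ≥0∞} {i : α} (hi : a i ≠ 0)
    (hf : ∀ j, T j = T i → f j = f i) : condAvg a T f i = f i := by
  have : classSum a T f i = f i * classSum a T (fun _ => 1) i := by
    rw [classSum, classSum, ← ENNReal.tsum_mul_left]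
    refine tsum_congr fun j => ?_
    split_ifs with h
    · rw [hf j h]; ring
    · simp
  rw [condAvg, this]
  exact ENNReal.mul_div_cancel_right (classSum_one_ne_zero hi) (classSum_one_ne_top ha i)

lemma condAvg_le_one {f : α → ℝ≥0∞} (hf : ∀ i, f i ≤ 1) (i : α) : condAvg a T f i ≤ 1 := by
  refine le_trans (ENNReal.div_le_div_right (ENNReal.tsum_le_tsum fun j => ?_) _)
    ENNReal.div_self_le_one
  split_ifs
  · gcongr; exact hf j
  · rfl

lemma condAvg_eq_zero {f : α → ℝ≥0∞} {i : α} (hf : ∀ j, T j = T i → f j = 0) :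
    condAvg a T f i = 0 := by
  have : classSum a T f i = 0 := by
    refine ENNReal.tsum_eq_zero.2 fun j => ?_
    split_ifs with h
    · rw [hf j h, mul_zero]
    · rfl
  rw [condAvg, this, ENNReal.zero_div]

end CondAvg

/-! ### Sums against a product of weights -/

/-- The integral of `F` against the product of the measures with weights `a` and `b`. -/
noncomputable def pairSum {α β : Type*} (a : α → ℝ≥0∞) (b : β → ℝ≥0∞) (F : α → β → ℝ≥0∞) :
    ℝ≥0∞ :=
  ∑' i, ∑' j, a i * (b j * F i j)

/-- Conditional expectation in the first variable of a product. -/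
noncomputable def condLeft {α β D : Type*} (a : α → ℝ≥0∞) (T : α → D) (F : α → β → ℝ≥0∞) :
    α → β → ℝ≥0∞ :=
  fun i j => condAvg a T (fun i' => F i' j) i

/-- Conditional expectation in the second variable of a product. -/
noncomputable def condRight {α β D : Type*} (b : β → ℝ≥0∞) (U : β → D) (F : α → β → ℝ≥0∞) :
    α → β → ℝ≥0∞ :=
  fun i j => condAvg b U (F i) j

section PairSum

variable {α β D : Type*} {a : α → ℝ≥0∞} {b : β → ℝ≥0∞}

lemma pairSum_congr {F G : α → β → ℝ≥0∞}
    (h : ∀ i j, a i ≠ 0 → b j ≠ 0 → F i j = G i j) : pairSum a b F = pairSum a b G := by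
  refine tsum_congr fun i => tsum_congr fun j => ?_
  by_cases hi : a i = 0
  · simp [hi]
  by_cases hj : b j = 0
  · simp [hj]
  rw [h i j hi hj]

lemma pairSum_mono {F G : α → β → ℝ≥0∞} (h : ∀ i j, F i j ≤ G i j) :
    pairSum a b F ≤ pairSum a b G :=
  ENNReal.tsum_le_tsum fun i => ENNReal.tsum_le_tsum fun j => by gcongr; exact h i j

lemma pairSum_add (F G : α → β → ℝ≥0∞) :
    pairSum a b (fun i j => F i j + G i j) = pairSum a b F + pairSum a b G := by
  simp only [pairSum, mul_add, ENNReal.tsum_add]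

lemma pairSum_const_mul (c : ℝ≥0∞) (F : α → β → ℝ≥0∞) :
    pairSum a b (fun i j => c * F i j) = c * pairSum a b F := by
  simp only [pairSum, ← ENNReal.tsum_mul_left]
  exact tsum_congr fun i => tsum_congr fun j => by ring

lemma pairSum_sum {ι : Type*} (s : Finset ι) (F : ι → α → β → ℝ≥0∞) :
    pairSum a b (fun i j => ∑ n ∈ s, F n i j) = ∑ n ∈ s, pairSum a b (F n) := by
  classical
  induction s using Finset.induction_on with
  | empty => simp [pairSum]
  | insert n s hn ih => simp only [Finset.sum_insert hn, pairSum_add, ih]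

lemma pairSum_condRight_mul (U : β → D) (F G : α → β → ℝ≥0∞) :
    pairSum a b (fun i j => condRight b U F i j * G i j) =
      pairSum a b (fun i j => F i j * condRight b U G i j) := by
  refine tsum_congr fun i => ?_
  rw [ENNReal.tsum_mul_left, ENNReal.tsum_mul_left]
  exact congrArg _ (tsum_condAvg_mul (F i) (G i))

lemma pairSum_condLeft_mul (T : α → D) (F G : α → β → ℝ≥0∞) :
    pairSum a b (fun i j => condLeft a T F i j * G i j) =
      pairSum a b (fun i j => F i j * condLeft a T G i j) := by
  simp only [pairSum]
  rw [ENNReal.tsum_comm]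
  conv_rhs => rw [ENNReal.tsum_comm]
  refine tsum_congr fun j => ?_
  simp only [mul_left_comm (a _) (b j)]
  rw [ENNReal.tsum_mul_left, ENNReal.tsum_mul_left]
  exact congrArg _ (tsum_condAvg_mul (fun i => F i j) (fun i => G i j))

lemma pairSum_condRight (hb : ∑' j, b j ≠ ∞) (U : β → D) (F : α → β → ℝ≥0∞) :
    pairSum a b (condRight b U F) = pairSum a b F := by
  have := pairSum_condRight_mul (a := a) (b := b) U F (fun _ _ => 1)
  simp only [mul_one] at this
  rw [show pairSum a b (condRight b U F) = _ from this]
  refine pairSum_congr fun i j _ hj => ?_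
  rw [condRight, condAvg_of_const_on_class hb hj (fun _ _ => rfl), mul_one]

lemma pairSum_condLeft (ha : ∑' i, a i ≠ ∞) (T : α → D) (F : α → β → ℝ≥0∞) :
    pairSum a b (condLeft a T F) = pairSum a b F := by
  have := pairSum_condLeft_mul (a := a) (b := b) T F (fun _ _ => 1)
  simp only [mul_one] at this
  rw [show pairSum a b (condLeft a T F) = _ from this]
  refine pairSum_congr fun i j hi _ => ?_
  rw [condLeft, condAvg_of_const_on_class ha hi (fun _ _ => rfl), mul_one]

end PairSum

/-! ### The second moment of the projected counting variable -/

/-- A family `U` of maps, increasing in information, such that given `Y n` the map `U n` carries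
no further information on `Y n'` for `n ≤ n'`: the Markov property of `Y` for the weights `b`,
with `U n` in the role of the past up to time `n`. Used over the opposite order, it is the Markov
property of the time reversal. -/
structure IsMarkovFor {ι β S D : Type*} [LinearOrder ι] (b : β → ℝ≥0∞) (Y : ι → β → S)
    (U : ι → β → D) : Prop where
  mono : ∀ n n', n ≤ n' → ∀ j j', U n' j = U n' j' → U n j = U n j'
  markov : ∀ n n', n ≤ n' → ∀ (v : S → ℝ≥0∞) (j : β), b j ≠ 0 →
    condAvg b (U n) (fun j => v (Y n' j)) j = condAvg b (Y n) (fun j => v (Y n' j)) j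

/-- The conditional expectation given `X m` and `Y n`. -/
noncomputable def condPair {α β S : Type*} (a : α → ℝ≥0∞) (b : β → ℝ≥0∞) (X : α → S) (Y : β → S)
    (F : α → β → ℝ≥0∞) : α → β → ℝ≥0∞ :=
  condLeft a X (condRight b Y F)

section SecondMoment

variable {κ ι α β S D D' : Type*} {a : α → ℝ≥0∞} {b : β → ℝ≥0∞}

lemma pairSum_condPair (ha : ∑' i, a i ≠ ∞) (hb : ∑' j, b j ≠ ∞) (X : α → S) (Y : β → S)
    (F : α → β → ℝ≥0∞) : pairSum a b (condPair a b X Y F) = pairSum a b F := by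
  rw [condPair, pairSum_condLeft ha, pairSum_condRight hb]

lemma condPair_congr (X : α → S) (Y : β → S) (F : α → β → ℝ≥0∞) {i i' : α} {j j' : β}
    (hi : X i = X i') (hj : Y j = Y j') : condPair a b X Y F i j = condPair a b X Y F i' j' := by
  rw [condPair, condLeft, condLeft, condAvg_congr_class _ hi]
  congr 1
  ext i''
  exact condAvg_congr_class _ hj

lemma exists_condPair_eq (a : α → ℝ≥0∞) (b : β → ℝ≥0∞) (X : α → S) (Y : β → S)
    (F : α → β → ℝ≥0∞) : ∃ v : S → S → ℝ≥0∞, ∀ i j, condPair a b X Y F i j = v (X i) (Y j) := by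
  classical
  refine ⟨fun x y => if h : ∃ i j, X i = x ∧ Y j = y then
    condPair a b X Y F h.choose h.choose_spec.choose else 0, fun i j => ?_⟩
  have h : ∃ i' j', X i' = X i ∧ Y j' = Y j := ⟨i, j, rfl, rfl⟩
  refine Eq.trans ?_ (dif_pos h).symm
  exact condPair_congr _ _ _ h.choose_spec.choose_spec.1.symm h.choose_spec.choose_spec.2.symm

lemma condPair_le_one {X : α → S} {Y : β → S} {F : α → β → ℝ≥0∞} (hF : ∀ i j, F i j ≤ 1) (i : α)
    (j : β) : condPair a b X Y F i j ≤ 1 :=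
  condAvg_le_one (fun i' => condAvg_le_one (hF i') j) i

lemma condPair_eq_zero {X : α → S} {Y : β → S} {F : α → β → ℝ≥0∞}
    (hF : ∀ i j, X i ≠ Y j → F i j = 0) {i : α} {j : β} (h : X i ≠ Y j) :
    condPair a b X Y F i j = 0 :=
  condAvg_eq_zero fun i' hi => condAvg_eq_zero fun j' hj => hF i' j' (by rwa [hi, hj])

variable [LinearOrder κ] [LinearOrder ι]
  {X : κ → α → S} {Y : ι → β → S} {T : κ → α → D} {U : ι → β → D'}

/-- Against a function of `X m'` and `Y n'`, with `m ≤ m'` and `n ≤ n'`, the projection on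
`(X m, Y n)` of a function that depends on the first chain only through its past up to `m` may be
replaced by its projection on the past of the second chain up to `n`. -/
lemma pairSum_condPair_mul (ha : ∑' i, a i ≠ ∞) (hX : IsMarkovFor a X T)
    (hY : IsMarkovFor b Y U) {e : α → β → ℝ≥0∞} {m m' : κ} {n n' : ι} (hm : m ≤ m') (hn : n ≤ n')
    (he : ∀ i i' j, T m i = T m i' → e i j = e i' j) {V : α → β → ℝ≥0∞} (v : S → S → ℝ≥0∞)
    (hV : ∀ i j, V i j = v (X m' i) (Y n' j)) :
    pairSum a b (fun i j => condPair a b (X m) (Y n) e i j * V i j) =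
      pairSum a b (fun i j => condRight b (U n) e i j * V i j) := by
  obtain rfl : V = fun i j => v (X m' i) (Y n' j) := by ext i j; exact hV i j
  have h1 : pairSum a b (fun i j => condPair a b (X m) (Y n) e i j * v (X m' i) (Y n' j)) =
      pairSum a b (fun i j => condRight b (Y n) e i j *
        condLeft a (T m) (fun i j => v (X m' i) (Y n' j)) i j) := by
    rw [condPair, pairSum_condLeft_mul]
    refine pairSum_congr fun i j hi _ => ?_
    congr 1
    exact (hX.markov m m' hm (fun x => v x (Y n' j)) i hi).symm
  rw [h1, pairSum_condRight_mul]
  have h2 : pairSum a b (fun i j => e i j * condRight b (Y n)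
        (condLeft a (T m) (fun i j => v (X m' i) (Y n' j))) i j) =
      pairSum a b (fun i j => e i j * condRight b (U n)
        (condLeft a (T m) (fun i j => v (X m' i) (Y n' j))) i j) := by
    refine pairSum_congr fun i j _ hj => ?_
    congr 1
    exact (hY.markov n n' hn (fun y => condAvg a (T m) (fun i' => v (X m' i') y) i) j hj).symm
  rw [h2, ← pairSum_condRight_mul, ← pairSum_condLeft_mul]
  refine pairSum_congr fun i j hi _ => ?_
  congr 1
  refine condAvg_of_const_on_class ha hi fun i' hi' => ?_
  simp only [condRight]
  congr 1
  ext j'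
  exact he _ _ _ hi'

lemma sum_mul_sum_le_two_mul {N : Type*} [Fintype N] [LinearOrder N] (f : N → N → ℝ≥0∞)
    (hf : ∀ n n', f n n' = f n' n) :
    ∑ n, ∑ n', f n n' ≤ 2 * ∑ n, ∑ n', if n ≤ n' then f n n' else 0 := by
  have h : ∑ n, ∑ n', f n n' ≤ ∑ n, ∑ n', ((if n ≤ n' then f n n' else 0) +
      if n' ≤ n then f n n' else 0) := by
    refine Finset.sum_le_sum fun n _ => Finset.sum_le_sum fun n' _ => ?_
    rcases le_total n n' with h | h <;> simp [h]
  refine h.trans_eq ?_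
  simp only [Finset.sum_add_distrib, two_mul]
  congr 1
  rw [Finset.sum_comm]
  exact Finset.sum_congr rfl fun n _ => Finset.sum_congr rfl fun n' _ => by rw [hf]

variable [Fintype κ] [Fintype ι]

/-- The energy estimate for the projections `q n` of subindicators `e n` on an increasing family:
the second moment of `∑ q n` is at most twice the first moment. Indeed
`E[q n * q n'] = E[q n * e n']` for `n ≤ n'`, and `∑ e n' ≤ 1`. -/
lemma pairSum_sq_sum_condRight_le (hb : ∑' j, b j ≠ ∞) (hY : IsMarkovFor b Y U)
    {e : ι → α → β → ℝ≥0∞} (he : ∀ i j, ∑ n, e n i j ≤ 1) :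
    pairSum a b (fun i j => (∑ n, condRight b (U n) (e n) i j) ^ 2) ≤
      2 * pairSum a b (fun i j => ∑ n, e n i j) := by
  set q : ι → α → β → ℝ≥0∞ := fun n => condRight b (U n) (e n) with hq
  have h1 : pairSum a b (fun i j => (∑ n, q n i j) ^ 2) =
      ∑ n, ∑ n', pairSum a b (fun i j => q n i j * q n' i j) := by
    simp only [sq, Finset.sum_mul_sum, pairSum_sum]
  have h2 : ∀ n n', n ≤ n' → pairSum a b (fun i j => q n i j * q n' i j) =
      pairSum a b (fun i j => q n i j * e n' i j) := by
    intro n n' hn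
    simp only [mul_comm (q n _ _)]
    rw [hq, pairSum_condRight_mul]
    refine pairSum_congr fun i j _ hj => ?_
    congr 1
    refine condAvg_of_const_on_class hb hj fun j' hj' => ?_
    exact condAvg_congr_class _ (hY.mono n n' hn _ _ hj')
  change pairSum a b (fun i j => (∑ n, q n i j) ^ 2) ≤ _
  rw [h1]
  refine (sum_mul_sum_le_two_mul _ fun n n' => by simp only [mul_comm]).trans ?_
  rw [pairSum_sum]
  gcongr with n
  calc ∑ n', (if n ≤ n' then pairSum a b (fun i j => q n i j * q n' i j) else 0)
      ≤ ∑ n', pairSum a b (fun i j => q n i j * e n' i j) := by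
        refine Finset.sum_le_sum fun n' _ => ?_
        split_ifs with h
        · exact (h2 n n' h).le
        · exact zero_le
    _ = pairSum a b (fun i j => q n i j * ∑ n', e n' i j) := by
        simp only [Finset.mul_sum, pairSum_sum]
    _ ≤ pairSum a b (q n) := pairSum_mono fun i j => mul_le_of_le_one_right' (he i j)
    _ = pairSum a b (e n) := pairSum_condRight hb _ _

lemma two_mul_le_sq_add_sq (x y : ℝ≥0∞) : 2 * (x * y) ≤ x ^ 2 + y ^ 2 := by
  rcases le_total x y with h | h
  all_goals
    obtain ⟨d, rfl⟩ := exists_add_of_le h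
    ring_nf
    exact le_self_add

/-- One of the two ordered halves of the second moment of `∑ W m n`, where
`W m n = E[e m n | X m, Y n]`. -/
lemma ordered_second_moment_le (ha : ∑' i, a i ≠ ∞) (hb : ∑' j, b j ≠ ∞)
    (hX : IsMarkovFor a X T) (hY : IsMarkovFor b Y U) {e : κ → ι → α → β → ℝ≥0∞}
    (he : ∀ m n i i' j, T m i = T m i' → e m n i j = e m n i' j)
    (he1 : ∀ i j, ∑ n, ∑ m, e m n i j ≤ 1) :
    8 * (∑ m, ∑ m', if m ≤ m' then ∑ n, ∑ n', if n ≤ n' then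
        pairSum a b (fun i j => condPair a b (X m) (Y n) (e m n) i j *
          condPair a b (X m') (Y n') (e m' n') i j) else 0 else 0) ≤
      32 * pairSum a b (fun i j => ∑ n, ∑ m, e m n i j) +
        pairSum a b (fun i j => (∑ m, ∑ n, condPair a b (X m) (Y n) (e m n) i j) ^ 2) := by
  set W : κ → ι → α → β → ℝ≥0∞ := fun m n => condPair a b (X m) (Y n) (e m n) with hW
  set Q : α → β → ℝ≥0∞ := fun i j => ∑ n, condRight b (U n) (fun i j => ∑ m, e m n i j) i j with hQ
  have hQ' : ∀ i j, Q i j = ∑ m, ∑ n, condRight b (U n) (e m n) i j := by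
    intro i j
    rw [Finset.sum_comm, hQ]
    refine Finset.sum_congr rfl fun n _ => ?_
    simp only [condRight, condAvg, classSum, div_eq_mul_inv]
    rw [← Finset.sum_mul]
    congr 1
    rw [← Summable.tsum_finsetSum fun _ _ => ENNReal.summable]
    refine tsum_congr fun j' => ?_
    split_ifs
    · rw [Finset.mul_sum]
    · simp
  have h1 : (∑ m, ∑ m', if m ≤ m' then ∑ n, ∑ n', if n ≤ n' then
      pairSum a b (fun i j => W m n i j * W m' n' i j) else 0 else 0) ≤
      pairSum a b (fun i j => Q i j * ∑ m, ∑ n, W m n i j) := by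
    have : pairSum a b (fun i j => Q i j * ∑ m, ∑ n, W m n i j) =
        ∑ m, ∑ m', ∑ n, ∑ n', pairSum a b (fun i j => condRight b (U n) (e m n) i j *
          W m' n' i j) := by
      simp only [hQ', Finset.sum_mul_sum, pairSum_sum]
    rw [this]
    refine Finset.sum_le_sum fun m _ => Finset.sum_le_sum fun m' _ => ?_
    split_ifs with hm
    · refine Finset.sum_le_sum fun n _ => Finset.sum_le_sum fun n' _ => ?_
      split_ifs with hn
      · obtain ⟨v, hv⟩ := exists_condPair_eq a b (X m') (Y n') (e m' n')
        exact (pairSum_condPair_mul ha hX hY hm hn (he m n) v hv).le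
      · exact zero_le
    · exact zero_le
  have h2 : pairSum a b (fun i j => Q i j ^ 2) ≤
      2 * pairSum a b (fun i j => ∑ n, ∑ m, e m n i j) :=
    pairSum_sq_sum_condRight_le hb hY (e := fun n i j => ∑ m, e m n i j) he1
  -- The weights in `2xy ≤ x² + y²`, with `x = 4Q`, are such that adding the two ordered halves
  -- leaves a part of the second moment to be absorbed.
  calc _ ≤ 8 * pairSum a b (fun i j => Q i j * ∑ m, ∑ n, W m n i j) := by gcongr
    _ = pairSum a b (fun i j => 2 * ((4 * Q i j) * ∑ m, ∑ n, W m n i j)) := by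
        rw [← pairSum_const_mul]; congr 1; ext i j; ring
    _ ≤ pairSum a b (fun i j => 16 * Q i j ^ 2 + (∑ m, ∑ n, W m n i j) ^ 2) := by
        refine pairSum_mono fun i j => (two_mul_le_sq_add_sq _ _).trans_eq ?_
        ring
    _ = 16 * pairSum a b (fun i j => Q i j ^ 2) +
          pairSum a b (fun i j => (∑ m, ∑ n, W m n i j) ^ 2) := by
        rw [pairSum_add, pairSum_const_mul]
    _ ≤ 16 * (2 * pairSum a b (fun i j => ∑ n, ∑ m, e m n i j)) +
          pairSum a b (fun i j => (∑ m, ∑ n, W m n i j) ^ 2) := by gcongr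
    _ = _ := by rw [← mul_assoc]; norm_num [hW]

/-- The second moment of `∑ E[e m n | X m, Y n]`, for subindicators `e m n` that depend on the
first chain only through its past, is bounded by a multiple of the first moment. The pairs of
indices are split according to the two possible orders in the second chain; in one of them the
time reversal of the second chain is used. -/
lemma second_moment_le {D'' : Type*} {U' : ι → β → D''} (ha : ∑' i, a i ≠ ∞)
    (hb : ∑' j, b j ≠ ∞) (hX : IsMarkovFor a X T) (hY : IsMarkovFor b Y U)
    (hY' : IsMarkovFor (ι := ιᵒᵈ) b Y U') {e : κ → ι → α → β → ℝ≥0∞}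
    (he : ∀ m n i i' j, T m i = T m i' → e m n i j = e m n i' j)
    (he1 : ∀ i j, ∑ n, ∑ m, e m n i j ≤ 1) :
    pairSum a b (fun i j => (∑ m, ∑ n, condPair a b (X m) (Y n) (e m n) i j) ^ 2) ≤
      32 * pairSum a b (fun i j => ∑ n, ∑ m, e m n i j) := by
  set E2 := pairSum a b (fun i j => (∑ m, ∑ n, condPair a b (X m) (Y n) (e m n) i j) ^ 2) with hE2
  set E1 := pairSum a b (fun i j => ∑ n, ∑ m, e m n i j)
  have h1 := ordered_second_moment_le ha hb hX hY he he1
  have h2 := ordered_second_moment_le (ι := ιᵒᵈ) ha hb hX hY' (e := e) he he1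
  set c : κ → κ → ι → ι → ℝ≥0∞ := fun m m' n n' =>
    pairSum a b (fun i j => condPair a b (X m) (Y n) (e m n) i j *
          condPair a b (X m') (Y n') (e m' n') i j) with hc
  set A := ∑ m, ∑ m', if m ≤ m' then ∑ n, ∑ n', if n ≤ n' then c m m' n n' else 0 else 0
  set B := ∑ m, ∑ m', if m ≤ m' then ∑ n, ∑ n', if n' ≤ n then c m m' n n' else 0 else 0
  replace h1 : 8 * A ≤ 32 * E1 + E2 := h1
  replace h2 : 8 * B ≤ 32 * E1 + E2 := h2
  have hE : E2 = ∑ m, ∑ m', ∑ n, ∑ n', c m m' n n' := by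
    simp only [hE2, hc, sq, Finset.sum_mul_sum, pairSum_sum]
  have hAB : E2 ≤ 2 * (A + B) := by
    rw [hE]
    refine (sum_mul_sum_le_two_mul (fun m m' => ∑ n, ∑ n', c m m' n n') fun m m' => ?_).trans ?_
    · rw [Finset.sum_comm]
      simp only [hc, mul_comm]
    · simp only [A, B, ← Finset.sum_add_distrib]
      gcongr with m _ m' _
      split_ifs with hm
      · rw [← Finset.sum_add_distrib]
        gcongr with n _
        rw [← Finset.sum_add_distrib]
        gcongr with n' _
        rcases le_total n n' with h | h <;> simp [h]
      · simp
  -- Conditional probabilities are at most `1`, so the sum is bounded and `E2` can be cancelled.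
  have hfin : E2 ≠ ∞ := by
    refine ne_top_of_le_ne_top (b := pairSum a b fun _ _ =>
      ((Fintype.card κ * Fintype.card ι : ℕ) : ℝ≥0∞) ^ 2) ?_ (pairSum_mono fun i j => ?_)
    · simp only [pairSum, ENNReal.tsum_mul_left, ENNReal.tsum_mul_right]
      exact ENNReal.mul_ne_top ha (ENNReal.mul_ne_top hb
        (ENNReal.pow_ne_top (ENNReal.natCast_ne_top _)))
    · gcongr
      calc _ ≤ ∑ _m : κ, ∑ _n : ι, (1 : ℝ≥0∞) := by
            gcongr with m _ n _
            refine condPair_le_one (fun i j => le_trans ?_ (he1 i j)) i j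
            exact (Finset.single_le_sum_of_canonicallyOrdered (f := fun m => e m n i j)
              (Finset.mem_univ m)).trans (Finset.single_le_sum_of_canonicallyOrdered
              (f := fun n => ∑ m, e m n i j) (Finset.mem_univ n))
        _ = _ := by simp
  have h4 : 2 * E2 + 2 * E2 ≤ 64 * E1 + 2 * E2 := by
    calc 2 * E2 + 2 * E2 = 4 * E2 := by ring
      _ ≤ 4 * (2 * (A + B)) := by gcongr
      _ = 8 * A + 8 * B := by ring
      _ ≤ (32 * E1 + E2) + (32 * E1 + E2) := add_le_add h1 h2
      _ = _ := by ring
  have h5 := ENNReal.le_of_add_le_add_right (ENNReal.mul_ne_top (by simp) hfin) h4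
  rw [show (64 : ℝ≥0∞) * E1 = 2 * (32 * E1) by rw [← mul_assoc]; norm_num] at h5
  exact (ENNReal.mul_le_mul_iff_right (by simp) (by simp)).1 h5

end SecondMoment

/-! ### The Markov property of finite paths -/

/-- Exchanging the parts of two independent copies that lie outside the class of `T` shows that
`T` and `f` are conditionally independent given `X`. -/
lemma condAvg_eq_of_splice {α D S : Type*} {a : α → ℝ≥0∞} (ha : ∑' i, a i ≠ ∞) {T : α → D}
    {X : α → S} {f : α → ℝ≥0∞} (splice : α → α → α)
    (hinv : ∀ j k, splice (splice j k) (splice k j) = j)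
    (hT : ∀ j k, X j = X k → T (splice j k) = T j) (hX : ∀ j k, X (splice j k) = X j)
    (hTX : ∀ j k, T j = T k → X j = X k)
    (hf : ∀ j k, X j = X k → f (splice j k) = f k)
    (hw : ∀ j k, X j = X k → a (splice j k) * a (splice k j) = a j * a k)
    {i : α} (hi : a i ≠ 0) : condAvg a T f i = condAvg a X f i := by
  classical
  rw [condAvg, condAvg, ENNReal.div_eq_div_iff (classSum_one_ne_zero hi)
    (classSum_one_ne_top ha i) (classSum_one_ne_zero hi) (classSum_one_ne_top ha i)]
  let σ : α × α ≃ α × α :=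
    { toFun := fun q => (splice q.1 q.2, splice q.2 q.1)
      invFun := fun q => (splice q.1 q.2, splice q.2 q.1)
      left_inv := fun q => by simp [hinv]
      right_inv := fun q => by simp [hinv] }
  have h1 : classSum a X (fun _ => 1) i * classSum a T f i = ∑' q : α × α,
      if T q.1 = T i ∧ X q.2 = X i then a q.1 * a q.2 * f q.1 else 0 := by
    rw [mul_comm, ENNReal.tsum_prod', classSum, ← ENNReal.tsum_mul_right]
    refine tsum_congr fun j => ?_
    rw [classSum, ← ENNReal.tsum_mul_left]
    refine tsum_congr fun k => ?_
    by_cases h : T j = T i <;> by_cases h' : X k = X i <;> simp [h, h']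
    ring
  have h2 : classSum a T (fun _ => 1) i * classSum a X f i = ∑' q : α × α,
      if T q.1 = T i ∧ X q.2 = X i then a q.1 * a q.2 * f q.2 else 0 := by
    rw [ENNReal.tsum_prod', classSum, ← ENNReal.tsum_mul_right]
    refine tsum_congr fun j => ?_
    rw [classSum, ← ENNReal.tsum_mul_left]
    refine tsum_congr fun k => ?_
    by_cases h : T j = T i <;> by_cases h' : X k = X i <;> simp [h, h']
    ring
  rw [h1, h2, ← σ.tsum_eq]
  refine tsum_congr fun q => ?_
  obtain ⟨j, k⟩ := q
  simp only [σ, Equiv.coe_fn_mk, hX]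
  by_cases hjk : X j = X k
  · rw [hT j k hjk, hf j k hjk, hw j k hjk]
  · have hn : ∀ j', T j' = T j → ¬ (T j' = T i ∧ X k = X i) := fun j' h' h =>
      hjk ((hTX _ _ (h'.symm.trans h.1)).trans h.2.symm)
    rw [if_neg (hn j rfl), if_neg]
    rintro ⟨h, h'⟩
    exact hjk (by rw [h', ← hX j k]; exact hTX _ _ h)

open Classical in
/-- The probability that a chain started at `x` begins with the path `s 0, …, s n`. -/
noncomputable def pathWeight {S : Type*} (p : S → PMF S) (x : S) (n : ℕ) (s : ℕ → S) : ℝ≥0∞ :=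
  (if s 0 = x then 1 else 0) * ∏ i ∈ Finset.range n, p (s i) (s (i + 1))

/-- The extension of a finite path by its last state. -/
def extend {S : Type*} {N : ℕ} (ξ : Fin (N + 1) → S) : ℕ → S :=
  fun i => ξ ⟨min i N, by omega⟩

section FinitePaths

variable {S : Type*} {N : ℕ}

lemma extend_apply (ξ : Fin (N + 1) → S) (i : Fin (N + 1)) : extend ξ i = ξ i := by
  simp only [extend]
  congr 1
  ext
  simp only
  omega

lemma extend_of_le (ξ : Fin (N + 1) → S) {i : ℕ} (hi : i ≤ N) :
    extend ξ i = ξ ⟨i, by omega⟩ := extend_apply ξ ⟨i, by omega⟩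

/-- Exchanging the tails of two paths that meet at time `m` preserves the product of weights. -/
lemma pathWeight_mul_splice (p : S → PMF S) (x : S) (m : Fin (N + 1)) (ξ ζ : Fin (N + 1) → S)
    (h : ξ m = ζ m) :
    pathWeight p x N (extend fun i => if i ≤ m then ξ i else ζ i) *
      pathWeight p x N (extend fun i => if i ≤ m then ζ i else ξ i) =
    pathWeight p x N (extend ξ) * pathWeight p x N (extend ζ) := by
  classical
  simp only [pathWeight]
  rw [mul_mul_mul_comm, mul_mul_mul_comm (if extend ξ 0 = x then 1 else 0)]
  congr 1
  rw [← Finset.prod_mul_distrib, ← Finset.prod_mul_distrib]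
  refine Finset.prod_congr rfl fun i hi => ?_
  have hi := Finset.mem_range.1 hi
  rw [extend_of_le _ hi.le, extend_of_le _ hi.le, extend_of_le _ hi.le, extend_of_le _ hi.le,
    extend_of_le _ (Nat.succ_le_of_lt hi), extend_of_le _ (Nat.succ_le_of_lt hi),
    extend_of_le _ (Nat.succ_le_of_lt hi), extend_of_le _ (Nat.succ_le_of_lt hi)]
  have e : ∀ (j : ℕ) (hj : j < N + 1), ((⟨j, hj⟩ : Fin (N + 1)) ≤ m) = (j ≤ (m : ℕ)) :=
    fun j hj => by rw [Fin.le_def]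
  simp only [e]
  rcases lt_trichotomy i (m : ℕ) with h' | h' | h'
  · rw [if_pos h'.le, if_pos h'.le, if_pos (Nat.succ_le_of_lt h'),
      if_pos (Nat.succ_le_of_lt h')]
  · have hm : m = ⟨i, by omega⟩ := by ext; exact h'.symm
    rw [hm] at h
    rw [if_pos h'.le, if_pos h'.le, if_neg (by omega), if_neg (by omega), h, mul_comm]
  · rw [if_neg (by omega), if_neg (by omega), if_neg (by omega), if_neg (by omega), mul_comm]

lemma isMarkovFor_past (p : S → PMF S) (x : S)
    (hfin : ∑' ξ : Fin (N + 1) → S, pathWeight p x N (extend ξ) ≠ ∞) :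
    IsMarkovFor (ι := Fin (N + 1)) (fun ξ : Fin (N + 1) → S => pathWeight p x N (extend ξ))
      (fun n ξ => ξ n) (fun n ξ i => ξ (min i n)) where
  mono n n' hn j j' h := by
    ext i
    have := congrFun h (min i n)
    simpa [min_assoc, hn] using this
  markov n n' hn v j hj := by
    refine condAvg_eq_of_splice hfin (fun ξ ζ i => if i ≤ n then ξ i else ζ i) ?_ ?_ ?_ ?_ ?_ ?_ hj
    · intro ξ ζ
      ext i
      by_cases h : i ≤ n <;> simp [h]
    · intro ξ ζ _
      ext i
      simp
    · intro ξ ζ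
      simp
    · intro ξ ζ h
      simpa using congrFun h n
    · intro ξ ζ h
      rcases hn.eq_or_lt with rfl | hn
      · simp [h]
      · simp [not_le.2 hn]
    · intro ξ ζ h
      exact pathWeight_mul_splice p x n ξ ζ h

lemma stop_future_congr {n n' : Fin (N + 1)} (hn : n' ≤ n) {ξ ζ : Fin (N + 1) → S}
    (h : (fun i => ξ (max i n')) = fun i => ζ (max i n')) :
    (fun i => ξ (max i n)) = fun i => ζ (max i n) := by
  ext i
  have := congrFun h (max i n)
  simpa [max_assoc, hn] using this

lemma condAvg_future (p : S → PMF S) (x : S)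
    (hfin : ∑' ξ : Fin (N + 1) → S, pathWeight p x N (extend ξ) ≠ ∞) {n n' : Fin (N + 1)}
    (hn : n' ≤ n) (v : S → ℝ≥0∞) {j : Fin (N + 1) → S} (hj : pathWeight p x N (extend j) ≠ 0) :
    condAvg (fun ξ : Fin (N + 1) → S => pathWeight p x N (extend ξ))
      (fun ξ i => ξ (max i n)) (fun ξ => v (ξ n')) j =
    condAvg (fun ξ : Fin (N + 1) → S => pathWeight p x N (extend ξ))
      (fun ξ => ξ n) (fun ξ => v (ξ n')) j := by
  refine condAvg_eq_of_splice hfin (fun ξ ζ i => if n ≤ i then ξ i else ζ i) ?_ ?_ ?_ ?_ ?_ ?_ hj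
  · intro ξ ζ
    ext i
    by_cases h : n ≤ i <;> simp [h]
  · intro ξ ζ _
    ext i
    simp
  · intro ξ ζ
    simp
  · intro ξ ζ h
    simpa using congrFun h n
  · intro ξ ζ h
    rcases hn.eq_or_lt with rfl | hn
    · simp [h]
    · simp [not_le.2 hn]
  · intro ξ ζ h
    have e : ∀ ξ ζ : Fin (N + 1) → S, ξ n = ζ n → (fun i => if n ≤ i then ξ i else ζ i) =
        fun i => if i ≤ n then ζ i else ξ i := by
      intro ξ ζ h
      ext i
      rcases lt_trichotomy i n with h' | rfl | h'
      · simp [h'.le, not_le.2 h']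
      · simp [h]
      · simp [h'.le, not_le.2 h']
    rw [e ξ ζ h, e ζ ξ h.symm, mul_comm, pathWeight_mul_splice p x n ξ ζ h]

lemma isMarkovFor_future (p : S → PMF S) (x : S)
    (hfin : ∑' ξ : Fin (N + 1) → S, pathWeight p x N (extend ξ) ≠ ∞) :
    IsMarkovFor (ι := (Fin (N + 1))ᵒᵈ) (fun ξ : Fin (N + 1) → S => pathWeight p x N (extend ξ))
      (fun (n : Fin (N + 1)) ξ => ξ n) (fun (n : Fin (N + 1)) ξ (i : Fin (N + 1)) =>
        ξ (max i n)) where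
  mono _ _ hn _ _ h := stop_future_congr (OrderDual.ofDual_le_ofDual.2 hn) h
  markov _ _ hn v _ hj := condAvg_future p x hfin (OrderDual.ofDual_le_ofDual.2 hn) v hj

end FinitePaths

/-! ### Laws of Markov chains on path space -/

/-- The set of paths that begin with `s 0, …, s n`. -/
def cylinder {S : Type*} (n : ℕ) (s : ℕ → S) : Set (ℕ → S) := {γ | ∀ i ≤ n, γ i = s i}

/-- The path after time `m`. -/
def shift {S : Type*} (m : ℕ) (γ : ℕ → S) : ℕ → S := fun i => γ (m + i)

/-- The measure `P` on path space is `r` times the law of the Markov chain with transition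
probabilities `p` started at `x`. -/
def IsPathLaw {S : Type*} [MeasurableSpace S] (p : S → PMF S) (x : S) (r : ℝ≥0∞)
    (P : Measure (ℕ → S)) : Prop :=
  ∀ n s, P (cylinder n s) = r * pathWeight p x n s

section PathLaw

variable {S : Type*} {p : S → PMF S} {x y : S}

lemma pathWeight_succ (n : ℕ) (s : ℕ → S) :
    pathWeight p x (n + 1) s = pathWeight p x n s * p (s n) (s (n + 1)) := by
  rw [pathWeight, pathWeight, Finset.prod_range_succ, mul_assoc]

/-- The path `s` up to time `m`, followed by `t`. -/
def concat (m : ℕ) (s t : ℕ → S) : ℕ → S := fun i => if i ≤ m then s i else t (i - m)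

lemma pathWeight_concat (m l : ℕ) {s t : ℕ → S} (h : t 0 = s m) :
    pathWeight p x (m + l) (concat m s t) =
      pathWeight p x m s * pathWeight p (s m) l t := by
  classical
  simp only [pathWeight, Finset.prod_range_add, h, if_true, one_mul, ← mul_assoc]
  congr 1
  · congr 1
    · refine Finset.prod_congr rfl fun i hi => ?_
      have := Finset.mem_range.1 hi
      simp only [concat]
      rw [if_pos (by omega), if_pos (by omega)]
  · refine Finset.prod_congr rfl fun i _ => ?_
    simp only [concat]
    rw [if_neg (by omega : ¬ m + i + 1 ≤ m), show m + i + 1 - m = i + 1 by omega]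
    split_ifs with h'
    · obtain rfl : i = 0 := by omega
      rw [h, Nat.add_zero]
    · rw [show m + i - m = i by omega]

lemma cylinder_inter_shift (m l : ℕ) {s t : ℕ → S} (h : t 0 = s m) :
    cylinder m s ∩ shift m ⁻¹' cylinder l t = cylinder (m + l) (concat m s t) := by
  ext γ
  simp only [cylinder, shift, concat, Set.mem_inter_iff, Set.mem_ofPred_eq, Set.mem_preimage]
  constructor
  · rintro ⟨h1, h2⟩ i hi
    split_ifs with h'
    · exact h1 i h'
    · have := h2 (i - m) (by omega)
      rwa [show m + (i - m) = i by omega] at this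
  · refine fun H => ⟨fun i hi => ?_, fun i hi => ?_⟩
    · rw [H i (by omega), if_pos hi]
    · rw [H (m + i) (by omega)]
      split_ifs with h'
      · obtain rfl : i = 0 := by omega
        rw [h, Nat.add_zero]
      · rw [show m + i - m = i by omega]

lemma cylinder_inter_shift_eq_empty (m l : ℕ) {s t : ℕ → S} (h : t 0 ≠ s m) :
    cylinder m s ∩ shift m ⁻¹' cylinder l t = ∅ := by
  ext γ
  simp only [cylinder, shift, Set.mem_inter_iff, Set.mem_ofPred_eq, Set.mem_preimage,
    Set.mem_empty_iff_false, iff_false]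
  rintro ⟨h1, h2⟩
  exact h (((h2 0 (Nat.zero_le _)).symm).trans (h1 m le_rfl))

lemma pathWeight_eq_zero (l : ℕ) {t : ℕ → S} (h : t 0 ≠ x) : pathWeight p x l t = 0 := by
  rw [pathWeight, if_neg h, zero_mul]

lemma cylinder_inter_of_mem {n n' : ℕ} (hn : n ≤ n') {s s' γ : ℕ → S} (h : γ ∈ cylinder n s)
    (h' : γ ∈ cylinder n' s') : cylinder n s ∩ cylinder n' s' = cylinder n' s' := by
  refine Set.inter_eq_right.2 fun δ hδ i hi => ?_
  rw [hδ i (hi.trans hn), ← h' i (hi.trans hn), h i hi]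

lemma isPiSystem_cylinder : IsPiSystem {C : Set (ℕ → S) | ∃ n s, C = cylinder n s} := by
  rintro _ ⟨n, s, rfl⟩ _ ⟨n', s', rfl⟩ ⟨γ, h, h'⟩
  rcases le_total n n' with hn | hn
  · exact ⟨n', s', cylinder_inter_of_mem hn h h'⟩
  · exact ⟨n, s, by rw [Set.inter_comm]; exact cylinder_inter_of_mem hn h' h⟩

lemma iUnion_cylinder_zero : ⋃ s : S, cylinder 0 (fun _ => s) = (Set.univ : Set (ℕ → S)) := by
  ext γ
  simp [cylinder]

variable [MeasurableSpace S]

lemma measurable_shift (m : ℕ) : Measurable (shift m : (ℕ → S) → ℕ → S) :=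
  measurable_pi_lambda _ fun _ => measurable_pi_apply _

variable [MeasurableSingletonClass S]

lemma measurableSet_cylinder (n : ℕ) (s : ℕ → S) : MeasurableSet (cylinder n s) := by
  have : cylinder n s = ⋂ i ≤ n, (fun γ : ℕ → S => γ i) ⁻¹' {s i} := by
    ext γ; simp [cylinder]
  rw [this]
  exact .iInter fun i => .iInter fun _ => measurable_pi_apply i (measurableSet_singleton _)

/-- The Markov property: given that the path begins with `s 0, …, s m`, the shifted path is the
chain started at `s m`. -/
lemma IsPathLaw.restrict_cylinder_map_shift {r : ℝ≥0∞} {P : Measure (ℕ → S)}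
    (h : IsPathLaw p x r P) (m : ℕ) (s : ℕ → S) :
    IsPathLaw p (s m) (P (cylinder m s)) ((P.restrict (cylinder m s)).map (shift m)) := by
  intro l t
  rw [Measure.map_apply (measurable_shift m) (measurableSet_cylinder _ _),
    Measure.restrict_apply (measurable_shift m (measurableSet_cylinder _ _)), Set.inter_comm]
  by_cases ht : t 0 = s m
  · rw [cylinder_inter_shift m l ht, h, pathWeight_concat m l ht, h, mul_assoc]
  · rw [cylinder_inter_shift_eq_empty m l ht, pathWeight_eq_zero l ht, measure_empty, mul_zero]

variable [Countable S]

lemma generateFrom_cylinder [Nonempty S] : (MeasurableSpace.pi : MeasurableSpace (ℕ → S)) =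
    MeasurableSpace.generateFrom {C | ∃ n s, C = cylinder n s} := by
  classical
  refine le_antisymm ?_ (MeasurableSpace.generateFrom_le ?_)
  · refine iSup_le fun n => ?_
    rintro _ ⟨B, -, rfl⟩
    have : (fun γ : ℕ → S => γ n) ⁻¹' B =
        ⋃ ξ : {ξ : Fin (n + 1) → S // ξ (Fin.last n) ∈ B}, cylinder n (extend ξ.1) := by
      ext γ
      simp only [Set.mem_preimage, Set.mem_iUnion, cylinder, Set.mem_ofPred_eq]
      constructor
      · intro hγ
        exact ⟨⟨fun i => γ i, hγ⟩, fun i hi => by rw [extend_of_le _ hi]⟩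
      · rintro ⟨ξ, hξ⟩
        rw [hξ n le_rfl, extend_of_le _ le_rfl]
        exact ξ.2
    rw [this]
    exact .iUnion fun ξ => MeasurableSpace.measurableSet_generateFrom ⟨_, _, rfl⟩
  · rintro _ ⟨n, s, rfl⟩
    exact measurableSet_cylinder n s

lemma IsPathLaw.apply_univ {r : ℝ≥0∞} {P : Measure (ℕ → S)} (h : IsPathLaw p x r P) :
    P Set.univ = r := by
  classical
  rw [← iUnion_cylinder_zero, measure_iUnion _ fun s => measurableSet_cylinder _ _]
  · simp [h 0, pathWeight]
  · intro s s' hs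
    refine Set.disjoint_left.2 fun γ h h' => hs ?_
    exact (h 0 le_rfl).symm.trans (h' 0 le_rfl)

/-- The law of the chain started at `x` is determined by its values on cylinders. -/
lemma IsPathLaw.smul_eq_smul {r r' : ℝ≥0∞} {P P' : Measure (ℕ → S)} [IsFiniteMeasure P]
    [IsFiniteMeasure P'] (h : IsPathLaw p x r P) (h' : IsPathLaw p x r' P') :
    r' • P = r • P' := by
  have : Nonempty S := ⟨x⟩
  have hr : r ≠ ∞ := by rw [← h.apply_univ]; exact measure_ne_top _ _
  have hr' : r' ≠ ∞ := by rw [← h'.apply_univ]; exact measure_ne_top _ _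
  have := P.smul_finite hr'
  refine ext_of_generate_finite _ generateFrom_cylinder isPiSystem_cylinder ?_ ?_
  · rintro _ ⟨n, s, rfl⟩
    simp only [Measure.smul_apply, smul_eq_mul, h n s, h' n s]
    ring
  · simp only [Measure.smul_apply, smul_eq_mul, h.apply_univ, h'.apply_univ, mul_comm]

/-- For two independent chains started at the same state, a total measurable relation between
paths holds with probability at least one half. -/
lemma IsPathLaw.mul_le_two_mul_prod {r r' : ℝ≥0∞} {P P' : Measure (ℕ → S)} [IsFiniteMeasure P]
    [IsFiniteMeasure P'] (h : IsPathLaw p x r P) (h' : IsPathLaw p x r' P')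
    {L : Set ((ℕ → S) × (ℕ → S))} (hL : MeasurableSet L) (htot : ∀ q, q ∈ L ∨ q.swap ∈ L) :
    r * r' ≤ 2 * (P.prod P') L := by
  have hr' : r' ≠ ∞ := by rw [← h'.apply_univ]; exact measure_ne_top _ _
  by_cases hr0 : r' = 0
  · simp [hr0]
  have h1 : r' * (P.prod P') L = r * (P'.prod P') L := by
    have := congrArg (fun M : Measure (ℕ → S) => (M.prod P') L) (h.smul_eq_smul h')
    simpa [Measure.prod_smul_left] using this
  have h2 : r' * r' ≤ 2 * (P'.prod P') L := by
    have hsw : (P'.prod P') (Prod.swap ⁻¹' L) = (P'.prod P') L := by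
      rw [← Measure.map_apply measurable_swap hL, Measure.prod_swap]
    calc r' * r' = (P'.prod P') Set.univ := by
          rw [← Set.univ_prod_univ, Measure.prod_prod, h'.apply_univ]
      _ ≤ (P'.prod P') (L ∪ Prod.swap ⁻¹' L) := measure_mono fun q _ => htot q
      _ ≤ (P'.prod P') L + (P'.prod P') (Prod.swap ⁻¹' L) := measure_union_le _ _
      _ = _ := by rw [hsw, two_mul]
  refine (ENNReal.mul_le_mul_iff_right hr0 hr').1 ?_
  calc r' * (r * r') = r * (r' * r') := by ring
    _ ≤ r * (2 * (P'.prod P') L) := by gcongr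
    _ = 2 * (r * (P'.prod P') L) := by ring
    _ = r' * (2 * (P.prod P') L) := by rw [← h1]; ring

end PathLaw

/-! ### Loop erasure of finite paths -/

/-- The times at which the loop-erasure of the finite path `γ 0, …, γ M` picks its states: after
the last visit up to time `M` to the current state. Once `M` is reached, the sequence stays
there. -/
noncomputable def eraseIndex {S : Type*} (γ : ℕ → S) (M : ℕ) : ℕ → ℕ
  | 0 => 0
  | j + 1 => min M (sSup {k | k ≤ M ∧ γ k = γ (eraseIndex γ M j)} + 1)

/-- The loop-erasure of the finite path `γ 0, …, γ M`, continued by its last state `γ M`. -/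
noncomputable def finiteErasure {S : Type*} (γ : ℕ → S) (M j : ℕ) : S := γ (eraseIndex γ M j)

/-- The pairs of paths `(f, g)` such that, among the entries of `u`, the first one visited by `g`
comes no later than the first one visited by `f`. -/
def hitsNoLater {S : Type*} (u : ℕ → S) : Set ((ℕ → S) × (ℕ → S)) :=
  {q | ∀ j, (∃ t, q.1 t = u j) → ∃ j' ≤ j, ∃ t, q.2 t = u j'}

section Erasure

variable {S : Type*}

lemma eraseIndex_le (γ : ℕ → S) (M j : ℕ) : eraseIndex γ M j ≤ M := by
  cases j with
  | zero => exact Nat.zero_le _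
  | succ j => exact min_le_left _ _

lemma min_le_eraseIndex (γ : ℕ → S) (M j : ℕ) : min M j ≤ eraseIndex γ M j := by
  induction j with
  | zero => simp
  | succ j ih =>
    have : eraseIndex γ M j ≤ sSup {k | k ≤ M ∧ γ k = γ (eraseIndex γ M j)} :=
      le_csSup ⟨M, fun k hk => hk.1⟩ ⟨eraseIndex_le γ M j, rfl⟩
    rw [eraseIndex]
    omega

lemma finiteErasure_self (γ : ℕ → S) (M : ℕ) : finiteErasure γ M M = γ M := by
  have h1 := min_le_eraseIndex γ M M
  have h2 := eraseIndex_le γ M M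
  rw [finiteErasure, show eraseIndex γ M M = M by omega]

lemma finiteErasure_congr {γ δ : ℕ → S} {M : ℕ} (h : ∀ i ≤ M, γ i = δ i) :
    finiteErasure γ M = finiteErasure δ M := by
  have key : ∀ j, eraseIndex γ M j = eraseIndex δ M j := by
    intro j
    induction j with
    | zero => rfl
    | succ j ih =>
      have : {k | k ≤ M ∧ γ k = γ (eraseIndex γ M j)} =
          {k | k ≤ M ∧ δ k = δ (eraseIndex δ M j)} := by
        ext k
        refine and_congr_right fun hk => ?_
        rw [h k hk, h _ (eraseIndex_le γ M j), ih]
      rw [eraseIndex, eraseIndex, this]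
  ext j
  rw [finiteErasure, finiteErasure, h _ (eraseIndex_le γ M j), key]

/-- The loop-erasure of an infinite path agrees with the one of its beginning up to and including
the first entry that is visited again at or after time `M`. -/
lemma loopErasure_eq_finiteErasure (γ : ℕ → S) (M : ℕ) {j : ℕ}
    (h : ∀ i < j, ∀ t, γ (M + t) ≠ finiteErasure γ M i) :
    loopErasure γ j = finiteErasure γ M j := by
  induction j with
  | zero => rfl
  | succ j ih =>
    have ih := ih fun i hi => h i (hi.trans (Nat.lt_succ_self j))
    have hj := h j (Nat.lt_succ_self j)
    rw [loopErasure, ih]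
    change _ = γ (min M (sSup {k | k ≤ M ∧ γ k = γ (eraseIndex γ M j)} + 1))
    have hM : ∀ k, γ k = finiteErasure γ M j → k < M := by
      intro k hk
      by_contra hlt
      exact hj (k - M) (by rwa [show M + (k - M) = k by omega])
    have hset : {k | k ≤ M ∧ γ k = γ (eraseIndex γ M j)} = {k | γ k = finiteErasure γ M j} := by
      ext k
      exact ⟨fun hk => hk.2, fun hk => ⟨(hM k hk).le, hk⟩⟩
    rw [hset, lastVisit]
    have hmem : sSup {k | γ k = finiteErasure γ M j} ∈ {k | γ k = finiteErasure γ M j} :=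
      Nat.sSup_mem ⟨eraseIndex γ M j, rfl⟩ ⟨M, fun k hk => (hM k hk).le⟩
    rw [min_eq_right (Nat.succ_le_of_lt (hM _ hmem))]

/-- If `η` after time `n` meets the loop-erasure of `γ 0, …, γ M` no later than `γ` after time `M`
does, then `η` meets the loop-erasure of `γ`: the entry where they meet is not erased. -/
lemma loopErasure_inter_nonempty {γ η : ℕ → S} {M n : ℕ}
    (h : (shift M γ, shift n η) ∈ hitsNoLater (finiteErasure γ M)) :
    (Set.range (loopErasure γ) ∩ Set.range η).Nonempty := by
  classical
  have hex : ∃ j, ∃ t, shift M γ t = finiteErasure γ M j := ⟨M, 0, (finiteErasure_self γ M).symm⟩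
  obtain ⟨j', hj', t, ht⟩ := h (Nat.find hex) (Nat.find_spec hex)
  refine ⟨finiteErasure γ M j', ⟨j', loopErasure_eq_finiteErasure γ M fun i hi t' ht' => ?_⟩,
    ⟨n + t, ht⟩⟩
  exact Nat.find_min hex (hi.trans_le hj') ⟨t', ht'⟩

lemma hitsNoLater_total (u : ℕ → S) (q : (ℕ → S) × (ℕ → S)) :
    q ∈ hitsNoLater u ∨ q.swap ∈ hitsNoLater u := by
  by_contra! H
  obtain ⟨h1, h2⟩ := H
  simp only [hitsNoLater, Set.mem_ofPred_eq, not_forall, not_exists, not_and, Prod.fst_swap,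
    Prod.snd_swap] at h1 h2
  obtain ⟨j, ⟨t, ht⟩, hj⟩ := h1
  obtain ⟨k, ⟨t', ht'⟩, hk⟩ := h2
  rcases le_total j k with h | h
  · exact hk j h t ht
  · exact hj k h t' ht'

lemma measurableSet_hitsNoLater [MeasurableSpace S] [MeasurableSingletonClass S] (u : ℕ → S) :
    MeasurableSet (hitsNoLater u) := by
  have h : ∀ (i : (ℕ → S) × (ℕ → S) → ℕ → S), Measurable i → ∀ j,
      MeasurableSet {q | ∃ t, i q t = u j} := by
    intro i hi j
    simp only [Set.ofPred_exists]
    exact .iUnion fun t => (measurable_pi_apply t).comp hi (measurableSet_singleton (u j))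
  have : hitsNoLater u = ⋂ j, ({q | ∃ t, q.1 t = u j}ᶜ ∪ ⋃ j' ≤ j, {q | ∃ t, q.2 t = u j'}) := by
    ext q
    simp [hitsNoLater, imp_iff_not_or]
  rw [this]
  exact .iInter fun j => (h _ measurable_fst j).compl.union
    (.iUnion fun j' => .iUnion fun _ => h _ measurable_snd j')

end Erasure

/-! ### Intersections of two chains -/

/-- The event that the paths `q.1` and `q.2` meet at times `m` and `n`, and after these times `q.2`
meets the loop-erasure of the past of `q.1`, including the prefix `x`, no later than `q.1` does. -/
def goodSet {S : Type*} {k : ℕ} (x : Fin k → S) (m n : ℕ) : Set ((ℕ → S) × (ℕ → S)) :=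
  {q | q.1 m = q.2 n ∧
    (shift m q.1, shift n q.2) ∈ hitsNoLater (finiteErasure (withPrefix x q.1) (k + m))}

/-- The event that the two paths begin with `ξ` and `ζ`, respectively. -/
def cell {S : Type*} {m n : ℕ} (ξ : Fin (m + 1) → S) (ζ : Fin (n + 1) → S) :
    Set ((ℕ → S) × (ℕ → S)) :=
  cylinder m (extend ξ) ×ˢ cylinder n (extend ζ)

open Classical in
/-- The indicator of the event that `(m, n)` is the lexicographically first pair of times at which
`ξ` and `ζ` meet. -/
noncomputable def firstMeeting {S : Type*} {N : ℕ} (m n : Fin (N + 1)) (ξ ζ : Fin (N + 1) → S) :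
    ℝ≥0∞ :=
  if ξ m = ζ n ∧ (∀ m' < m, ∀ n', ξ m' ≠ ζ n') ∧ ∀ n' < n, ξ m ≠ ζ n' then 1 else 0

section Meeting

variable {S : Type*}

lemma mem_range_inter_of_goodSet {k : ℕ} {x : Fin k → S} {m n : ℕ} {q : (ℕ → S) × (ℕ → S)}
    (h : q ∈ goodSet x m n) :
    (Set.range (loopErasure (withPrefix x q.1)) ∩ Set.range q.2).Nonempty := by
  refine loopErasure_inter_nonempty (M := k + m) (n := n) ?_
  have : shift (k + m) (withPrefix x q.1) = shift m q.1 := by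
    ext i
    simp only [shift, withPrefix]
    rw [dif_neg (by omega), show k + m + i - k = m + i by omega]
  rw [this]
  exact h.2

lemma cell_inter_goodSet {k : ℕ} (x : Fin k → S) {m n : ℕ} {s t : ℕ → S} (h : s m = t n) :
    cylinder m s ×ˢ cylinder n t ∩ goodSet x m n = Prod.map (shift m) (shift n) ⁻¹'
      hitsNoLater (finiteErasure (withPrefix x s) (k + m)) ∩ cylinder m s ×ˢ cylinder n t := by
  rw [Set.inter_comm]
  ext q
  refine and_congr_left fun hq => ?_
  have h1 : q.1 m = q.2 n := by rw [hq.1 m le_rfl, hq.2 n le_rfl, h]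
  have h2 : finiteErasure (withPrefix x q.1) (k + m) =
      finiteErasure (withPrefix x s) (k + m) := by
    refine finiteErasure_congr fun i hi => ?_
    simp only [withPrefix]
    split_ifs with h'
    · rfl
    · exact hq.1 _ (by omega)
  simp only [goodSet, Set.mem_ofPred_eq, h1, h2, true_and, Set.mem_preimage, Prod.map]

lemma cell_inter_goodSet_eq_empty {k : ℕ} (x : Fin k → S) {m n : ℕ} {s t : ℕ → S}
    (h : s m ≠ t n) : cylinder m s ×ˢ cylinder n t ∩ goodSet x m n = ∅ := by
  ext q
  simp only [Set.mem_inter_iff, Set.mem_empty_iff_false, iff_false, not_and]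
  intro hq hg
  exact h (by rw [← hq.1 m le_rfl, ← hq.2 n le_rfl, hg.1])

lemma iUnion_cell (m n : ℕ) :
    ⋃ z : (Fin (m + 1) → S) × (Fin (n + 1) → S), cell z.1 z.2 = Set.univ := by
  refine Set.eq_univ_of_forall fun q => Set.mem_iUnion.2 ⟨(fun i => q.1 i, fun i => q.2 i), ?_⟩
  exact ⟨fun i hi => by rw [extend_of_le _ hi], fun i hi => by rw [extend_of_le _ hi]⟩

lemma eq_of_mem_cylinder {n : ℕ} {ξ ζ : Fin (n + 1) → S} {γ : ℕ → S}
    (h : γ ∈ cylinder n (extend ξ)) (h' : γ ∈ cylinder n (extend ζ)) : ξ = ζ := by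
  ext i
  rw [← extend_apply ξ, ← extend_apply ζ, ← h i (by omega), h' i (by omega)]

lemma pairwise_disjoint_cell (m n : ℕ) : Pairwise (Function.onFun Disjoint
    fun z : (Fin (m + 1) → S) × (Fin (n + 1) → S) => cell z.1 z.2) := by
  intro z z' hz
  refine Set.disjoint_left.2 fun q h h' => hz ?_
  exact Prod.ext (eq_of_mem_cylinder h.1 h'.1) (eq_of_mem_cylinder h.2 h'.2)

open Classical in
/-- Paths that meet have exactly one first pair of meeting times. -/
lemma sum_firstMeeting {N : ℕ} (ξ ζ : Fin (N + 1) → S) :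
    ∑ n, ∑ m, firstMeeting m n ξ ζ = if ∃ m n, ξ m = ζ n then 1 else 0 := by
  split_ifs with h
  · obtain ⟨m, hm, hmin⟩ := wellFounded_lt.has_min {m | ∃ n, ξ m = ζ n} h
    obtain ⟨n, hn, hnmin⟩ := wellFounded_lt.has_min {n | ξ m = ζ n} hm
    have key : ∀ m' n', firstMeeting m' n' ξ ζ = if m' = m ∧ n' = n then 1 else 0 := by
      intro m' n'
      refine if_congr ⟨?_, ?_⟩ rfl rfl
      · rintro ⟨h1, h2, h3⟩
        obtain rfl : m' = m := by
          rcases lt_trichotomy m' m with h' | h' | h'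
          · exact (hmin _ ⟨_, h1⟩ h').elim
          · exact h'
          · exact (h2 m h' n hn).elim
        refine ⟨rfl, ?_⟩
        rcases lt_trichotomy n' n with h' | h' | h'
        · exact (hnmin _ h1 h').elim
        · exact h'
        · exact (h3 n h' hn).elim
      · rintro ⟨rfl, rfl⟩
        exact ⟨hn, fun m' h' n' e => hmin m' ⟨n', e⟩ h', fun n' h' e => hnmin n' e h'⟩
    simp only [key]
    rw [Finset.sum_eq_single n (by intro b _ hb; simp [hb]) (by simp)]
    simp
  · push Not at h
    exact Finset.sum_eq_zero fun n _ => Finset.sum_eq_zero fun m _ =>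
      if_neg fun h' => h m n h'.1

lemma firstMeeting_congr {N : ℕ} (m n : Fin (N + 1)) {ξ ξ' : Fin (N + 1) → S}
    (ζ : Fin (N + 1) → S) (h : (fun i => ξ (min i m)) = fun i => ξ' (min i m)) :
    firstMeeting m n ξ ζ = firstMeeting m n ξ' ζ := by
  classical
  have h' : ∀ i ≤ m, ξ i = ξ' i := fun i hi => by simpa [hi] using congrFun h i
  have h2 : (∀ i < m, ∀ n', ξ i ≠ ζ n') ↔ ∀ i < m, ∀ n', ξ' i ≠ ζ n' :=
    forall₂_congr fun i hi => by rw [h' i hi.le]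
  simp only [firstMeeting, h' m le_rfl, h2]

lemma const_mul_le_sq_add_const (s : ℝ≥0∞) : 128 * s ≤ s ^ 2 + 4096 := by
  have := two_mul_le_sq_add_sq s 64
  calc 128 * s = 2 * (s * 64) := by ring
    _ ≤ _ := this
    _ = _ := by norm_num

/-- The conditional probability, given the states at times `m` and `n`, that the chains started at
`x₀` and `y₀` meet first at times `m` and `n`. -/
noncomputable def meetingWeight (p : S → PMF S) (x₀ y₀ : S) {N : ℕ} (m n : Fin (N + 1)) :
    (Fin (N + 1) → S) → (Fin (N + 1) → S) → ℝ≥0∞ :=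
  condPair (fun ξ => pathWeight p x₀ N (extend ξ)) (fun ξ => pathWeight p y₀ N (extend ξ))
    (fun ξ => ξ m) (fun ξ => ξ n) (firstMeeting m n)

lemma exists_meetingWeight_eq (p : S → PMF S) (x₀ y₀ : S) {N : ℕ} (m n : Fin (N + 1)) :
    ∃ v : S → S → ℝ≥0∞, (∀ c d, c ≠ d → v c d = 0) ∧
      ∀ ξ ζ, meetingWeight p x₀ y₀ m n ξ ζ = v (ξ m) (ζ n) := by
  classical
  obtain ⟨v, hv⟩ := exists_condPair_eq (fun ξ => pathWeight p x₀ N (extend ξ))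
    (fun ξ => pathWeight p y₀ N (extend ξ)) (fun ξ : Fin (N + 1) → S => ξ m)
    (fun ξ : Fin (N + 1) → S => ξ n) (firstMeeting m n)
  refine ⟨fun c d => if c = d then v c d else 0, fun c d h => if_neg h, fun ξ ζ => ?_⟩
  by_cases h : ξ m = ζ n
  · exact (hv ξ ζ).trans (if_pos h).symm
  · refine Eq.trans ?_ (if_neg h).symm
    exact condPair_eq_zero (X := fun ξ : Fin (N + 1) → S => ξ m)
      (Y := fun ξ : Fin (N + 1) → S => ξ n) (fun i j hij => if_neg fun h' => hij h'.1) h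

lemma pairSum_sq_sum_meetingWeight_le {p : S → PMF S} {x₀ y₀ : S} {N : ℕ}
    (ha : ∑' ξ : Fin (N + 1) → S, pathWeight p x₀ N (extend ξ) ≠ ∞)
    (hb : ∑' ξ : Fin (N + 1) → S, pathWeight p y₀ N (extend ξ) ≠ ∞) :
    pairSum (fun ξ : Fin (N + 1) → S => pathWeight p x₀ N (extend ξ))
      (fun ξ : Fin (N + 1) → S => pathWeight p y₀ N (extend ξ))
      (fun ξ ζ => (∑ m, ∑ n, meetingWeight p x₀ y₀ m n ξ ζ) ^ 2) ≤
    32 * pairSum (fun ξ : Fin (N + 1) → S => pathWeight p x₀ N (extend ξ))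
      (fun ξ : Fin (N + 1) → S => pathWeight p y₀ N (extend ξ))
      (fun ξ ζ => ∑ n, ∑ m, firstMeeting m n ξ ζ) := by
  have he1 : ∀ ξ ζ : Fin (N + 1) → S, ∑ n, ∑ m, firstMeeting m n ξ ζ ≤ 1 := by
    intro ξ ζ
    rw [sum_firstMeeting]
    split_ifs <;> simp
  exact second_moment_le (e := firstMeeting) ha hb (isMarkovFor_past p x₀ ha)
    (isMarkovFor_past p y₀ hb) (isMarkovFor_future p y₀ hb)
    (fun m n _ _ ζ h => firstMeeting_congr m n ζ h) he1

variable [MeasurableSpace S] [MeasurableSingletonClass S]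

lemma measurableSet_cell {m n : ℕ} (ξ : Fin (m + 1) → S) (ζ : Fin (n + 1) → S) :
    MeasurableSet (cell ξ ζ) :=
  (measurableSet_cylinder _ _).prod (measurableSet_cylinder _ _)

variable [Countable S]
variable {p : S → PMF S} {x₀ y₀ : S} {P R : Measure (ℕ → S)}

lemma measurableSet_goodSet {k : ℕ} (x : Fin k → S) (m n : ℕ) :
    MeasurableSet (goodSet x m n) := by
  have : goodSet x m n = ⋃ z : (Fin (m + 1) → S) × (Fin (n + 1) → S),
      cell z.1 z.2 ∩ goodSet x m n := by
    rw [← Set.iUnion_inter, iUnion_cell, Set.univ_inter]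
  rw [this]
  refine .iUnion fun z => ?_
  by_cases h : extend z.1 m = extend z.2 n
  · rw [cell, cell_inter_goodSet x h]
    exact ((measurable_shift m).prodMap (measurable_shift n)
      (measurableSet_hitsNoLater _)).inter (measurableSet_cell z.1 z.2)
  · rw [cell, cell_inter_goodSet_eq_empty x h]
    exact .empty

/-- Given that the two chains meet at times `m` and `n`, and given their pasts, their futures are
independent with the same law, so that the good event has probability at least one half. -/
lemma measure_cell_le [IsProbabilityMeasure P] [IsProbabilityMeasure R]
    (hP : IsPathLaw p x₀ 1 P) (hR : IsPathLaw p y₀ 1 R) {k : ℕ} (x : Fin k → S) {m n : ℕ}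
    {s t : ℕ → S} (h : s m = t n) :
    (P.prod R) (cylinder m s ×ˢ cylinder n t) ≤
      2 * (P.prod R) (cylinder m s ×ˢ cylinder n t ∩ goodSet x m n) := by
  have h1 := hP.restrict_cylinder_map_shift m s
  have h2 := hR.restrict_cylinder_map_shift n t
  rw [← h] at h2
  have h3 := h1.mul_le_two_mul_prod h2
    (measurableSet_hitsNoLater (finiteErasure (withPrefix x s) (k + m))) (hitsNoLater_total _)
  rw [Measure.map_prod_map _ _ (measurable_shift m) (measurable_shift n), Measure.prod_restrict,
    Measure.map_apply ((measurable_shift m).prodMap (measurable_shift n))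
      (measurableSet_hitsNoLater _), Measure.restrict_apply
      ((measurable_shift m).prodMap (measurable_shift n) (measurableSet_hitsNoLater _)),
    ← cell_inter_goodSet x h] at h3
  rwa [Measure.prod_prod]

/-- A weight on the meeting at times `m` and `n` that depends only on the place of the meeting
keeps at least half of its mass on the good event. -/
lemma lintegral_meeting_le [IsProbabilityMeasure P] [IsProbabilityMeasure R]
    (hP : IsPathLaw p x₀ 1 P) (hR : IsPathLaw p y₀ 1 R) {k : ℕ} (x : Fin k → S) (m n : ℕ)
    (v : S → S → ℝ≥0∞) (hv : ∀ a b, a ≠ b → v a b = 0) :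
    ∫⁻ q, v (q.1 m) (q.2 n) ∂(P.prod R) ≤
      2 * ∫⁻ q in goodSet x m n, v (q.1 m) (q.2 n) ∂(P.prod R) := by
  set F : (ℕ → S) × (ℕ → S) → ℝ≥0∞ := fun q => v (q.1 m) (q.2 n)
  have h1 : ∫⁻ q, F q ∂(P.prod R) = ∑' z : (Fin (m + 1) → S) × (Fin (n + 1) → S),
      ∫⁻ q in cell z.1 z.2, F q ∂(P.prod R) := by
    rw [← lintegral_iUnion (s := fun z : (Fin (_ + 1) → S) × (Fin (_ + 1) → S) => cell z.1 z.2)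
      (fun z => measurableSet_cell z.1 z.2) (pairwise_disjoint_cell m n),
      iUnion_cell, Measure.restrict_univ]
  have h2 : ∫⁻ q in goodSet x m n, F q ∂(P.prod R) =
      ∑' z : (Fin (m + 1) → S) × (Fin (n + 1) → S),
        ∫⁻ q in cell z.1 z.2 ∩ goodSet x m n, F q ∂(P.prod R) := by
    rw [← lintegral_iUnion (s := fun z : (Fin (m + 1) → S) × (Fin (n + 1) → S) =>
        cell z.1 z.2 ∩ goodSet x m n)
      (fun z => (measurableSet_cell z.1 z.2).inter (measurableSet_goodSet x m n))
      (fun z z' hz => (pairwise_disjoint_cell m n hz).mono Set.inter_subset_left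
        Set.inter_subset_left), ← Set.iUnion_inter, iUnion_cell, Set.univ_inter]
  rw [h1, h2, ← ENNReal.tsum_mul_left]
  refine ENNReal.tsum_le_tsum fun z => ?_
  have hF : ∀ q ∈ cell z.1 z.2, F q = v (extend z.1 m) (extend z.2 n) := fun q hq => by
    simp only [F]; rw [hq.1 m le_rfl, hq.2 n le_rfl]
  rw [setLIntegral_congr_fun (measurableSet_cell z.1 z.2) hF, setLIntegral_const,
    setLIntegral_congr_fun ((measurableSet_cell z.1 z.2).inter (measurableSet_goodSet x m n))
      (fun q hq => hF q hq.1), setLIntegral_const]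
  by_cases h : extend z.1 m = extend z.2 n
  · calc _ ≤ v (extend z.1 m) (extend z.2 n) *
          (2 * (P.prod R) (cell z.1 z.2 ∩ goodSet x m n)) := by
          gcongr
          exact measure_cell_le hP hR x h
      _ = _ := by ring
  · rw [hv _ _ h]
    simp

lemma lintegral_prod_eq_pairSum [SFinite P] [SFinite R] (hP : IsPathLaw p x₀ 1 P)
    (hR : IsPathLaw p y₀ 1 R) {N : ℕ} (F : (Fin (N + 1) → S) → (Fin (N + 1) → S) → ℝ≥0∞) :
    ∫⁻ q, F (fun i => q.1 i) (fun i => q.2 i) ∂(P.prod R) =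
      pairSum (fun ξ => pathWeight p x₀ N (extend ξ)) (fun ξ => pathWeight p y₀ N (extend ξ)) F := by
  have h1 : ∫⁻ q, F (fun i => q.1 i) (fun i => q.2 i) ∂(P.prod R) =
      ∑' z : (Fin (N + 1) → S) × (Fin (N + 1) → S),
      ∫⁻ q in cell z.1 z.2, F (fun i => q.1 i) (fun i => q.2 i) ∂(P.prod R) := by
    rw [← lintegral_iUnion (s := fun z : (Fin (_ + 1) → S) × (Fin (_ + 1) → S) => cell z.1 z.2)
      (fun z => measurableSet_cell z.1 z.2) (pairwise_disjoint_cell N N),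
      iUnion_cell, Measure.restrict_univ]
  rw [h1, pairSum, ENNReal.tsum_prod']
  refine tsum_congr fun ξ => tsum_congr fun ζ => ?_
  have hF : ∀ q ∈ cell ξ ζ, F (fun i => q.1 i) (fun i => q.2 i) = F ξ ζ := by
    intro q hq
    congr 1
    · ext i
      rw [hq.1 i (by omega), extend_apply]
    · ext i
      rw [hq.2 i (by omega), extend_apply]
  rw [setLIntegral_congr_fun (measurableSet_cell ξ ζ) hF, setLIntegral_const, cell,
    Measure.prod_prod, hP, hR]
  ring

lemma IsPathLaw.tsum_pathWeight_ne_top [IsFiniteMeasure P] (hP : IsPathLaw p x₀ 1 P) (N : ℕ) :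
    ∑' ξ : Fin (N + 1) → S, pathWeight p x₀ N (extend ξ) ≠ ∞ := by
  have : ∀ ξ : Fin (N + 1) → S, pathWeight p x₀ N (extend ξ) = P (cylinder N (extend ξ)) :=
    fun ξ => by rw [hP, one_mul]
  simp only [this]
  rw [← measure_iUnion _ fun ξ => measurableSet_cylinder _ _]
  · exact measure_ne_top _ _
  · exact fun ξ ζ h => Set.disjoint_left.2 fun γ h1 h2 => h (eq_of_mem_cylinder h1 h2)

/-- The event that the paths meet before the time horizon. -/
def meetingBefore (S : Type*) (N : ℕ) : Set ((ℕ → S) × (ℕ → S)) :=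
  {q | ∃ m n : Fin (N + 1), q.1 m = q.2 n}

lemma measurableSet_meetingBefore (N : ℕ) : MeasurableSet (meetingBefore S N) := by
  have : meetingBefore S N = ⋃ (m : Fin (N + 1)) (n : Fin (N + 1)), {q | q.1 m = q.2 n} := by
    ext q; simp [meetingBefore]
  rw [this]
  exact .iUnion fun m => .iUnion fun n => measurableSet_eq_fun
    ((measurable_pi_apply _).comp measurable_fst) ((measurable_pi_apply _).comp measurable_snd)

lemma pairSum_firstMeeting [SFinite P] [SFinite R] (hP : IsPathLaw p x₀ 1 P)
    (hR : IsPathLaw p y₀ 1 R) (N : ℕ) :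
    pairSum (fun ξ : Fin (N + 1) → S => pathWeight p x₀ N (extend ξ))
      (fun ξ : Fin (N + 1) → S => pathWeight p y₀ N (extend ξ))
      (fun ξ ζ => ∑ n, ∑ m, firstMeeting m n ξ ζ) = (P.prod R) (meetingBefore S N) := by
  classical
  rw [← lintegral_prod_eq_pairSum hP hR, ← lintegral_indicator_one (measurableSet_meetingBefore N)]
  refine lintegral_congr fun q => ?_
  rw [sum_firstMeeting]
  simp only [Set.indicator, meetingBefore, Set.mem_ofPred_eq, Pi.one_apply]
  congr

lemma lintegral_sum_meetingWeight [IsFiniteMeasure P] [IsFiniteMeasure R]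
    (hP : IsPathLaw p x₀ 1 P) (hR : IsPathLaw p y₀ 1 R) (N : ℕ) :
    ∫⁻ q, (∑ m : Fin (N + 1), ∑ n : Fin (N + 1),
      meetingWeight p x₀ y₀ m n (fun i => q.1 i) (fun i => q.2 i)) ∂(P.prod R) =
      (P.prod R) (meetingBefore S N) := by
  rw [← pairSum_firstMeeting hP hR, lintegral_prod_eq_pairSum hP hR
    (fun ξ ζ => ∑ m, ∑ n, meetingWeight p x₀ y₀ m n ξ ζ)]
  simp only [pairSum_sum]
  rw [Finset.sum_comm]
  exact Finset.sum_congr rfl fun n _ => Finset.sum_congr rfl fun m _ =>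
    pairSum_condPair (hP.tsum_pathWeight_ne_top N) (hR.tsum_pathWeight_ne_top N)
      (fun ξ => ξ m) (fun ξ => ξ n) (firstMeeting m n)

lemma lintegral_sq_sum_meetingWeight_le [IsFiniteMeasure P] [IsFiniteMeasure R]
    (hP : IsPathLaw p x₀ 1 P) (hR : IsPathLaw p y₀ 1 R) (N : ℕ) :
    ∫⁻ q, (∑ m : Fin (N + 1), ∑ n : Fin (N + 1),
      meetingWeight p x₀ y₀ m n (fun i => q.1 i) (fun i => q.2 i)) ^ 2 ∂(P.prod R) ≤
      32 * (P.prod R) (meetingBefore S N) := by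
  rw [← pairSum_firstMeeting hP hR, lintegral_prod_eq_pairSum hP hR
    (fun ξ ζ => (∑ m, ∑ n, meetingWeight p x₀ y₀ m n ξ ζ) ^ 2)]
  exact pairSum_sq_sum_meetingWeight_le (hP.tsum_pathWeight_ne_top N) (hR.tsum_pathWeight_ne_top N)

/-- The comparison for the meetings up to a finite time horizon, by the second moment method: the
count `Z` of the weighted meetings has mean `M H` and second moment at most `32 * M H`, and at
least half of its mean comes from the union `G` of the good events. -/
lemma measure_meeting_horizon_le [IsProbabilityMeasure P] [IsProbabilityMeasure R]
    (hP : IsPathLaw p x₀ 1 P) (hR : IsPathLaw p y₀ 1 R) {k : ℕ} (x : Fin k → S) (N : ℕ) :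
    (P.prod R) (meetingBefore S N) ≤
      128 * (P.prod R) (⋃ m, ⋃ n, goodSet x m n) := by
  set M := P.prod R
  set H := meetingBefore S N
  set G := ⋃ m, ⋃ n, goodSet x m n
  set W : Fin (N + 1) → Fin (N + 1) → (Fin (N + 1) → S) → (Fin (N + 1) → S) → ℝ≥0∞ :=
    meetingWeight p x₀ y₀
  have hmeas : ∀ F : (Fin (N + 1) → S) → (Fin (N + 1) → S) → ℝ≥0∞,
      Measurable fun q : (ℕ → S) × (ℕ → S) => F (fun i => q.1 i) (fun i => q.2 i) := by
    intro F
    have hr : Measurable fun q : (ℕ → S) × (ℕ → S) =>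
        ((fun i => q.1 i : Fin (N + 1) → S), (fun i => q.2 i : Fin (N + 1) → S)) := by fun_prop
    exact (Measurable.of_discrete (f := fun z : (Fin (N + 1) → S) × (Fin (N + 1) → S) =>
      F z.1 z.2)).comp hr
  set Z : (ℕ → S) × (ℕ → S) → ℝ≥0∞ :=
    fun q => ∑ m, ∑ n, W m n (fun i => q.1 i) (fun i => q.2 i) with hZ
  have h1 : ∫⁻ q, Z q ∂M = M H := lintegral_sum_meetingWeight hP hR N
  have h2 : ∫⁻ q, Z q ^ 2 ∂M ≤ 32 * M H := lintegral_sq_sum_meetingWeight_le hP hR N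
  have h3 : M H ≤ 2 * ∫⁻ q in G, Z q ∂M := by
    rw [← h1]
    simp only [hZ]
    have hs : ∀ M' : Measure ((ℕ → S) × (ℕ → S)),
        ∫⁻ q, (∑ m, ∑ n, W m n (fun i => q.1 i) (fun i => q.2 i)) ∂M' =
        ∑ m, ∑ n, ∫⁻ q, W m n (fun i => q.1 i) (fun i => q.2 i) ∂M' := by
      intro M'
      rw [lintegral_finsetSum _ fun m _ => Finset.measurable_sum _ fun n _ => hmeas (W m n)]
      exact Finset.sum_congr rfl fun m _ => lintegral_finsetSum _ fun n _ => hmeas (W m n)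
    rw [hs, hs, Finset.mul_sum]
    refine Finset.sum_le_sum fun m _ => ?_
    rw [Finset.mul_sum]
    refine Finset.sum_le_sum fun n _ => ?_
    obtain ⟨v, hv0, hv⟩ := exists_meetingWeight_eq p x₀ y₀ m n
    simp only [W, hv]
    refine (lintegral_meeting_le hP hR x m n v hv0).trans ?_
    gcongr
    exact Set.subset_iUnion₂ (s := fun m n => goodSet x m n) (m : ℕ) (n : ℕ)
  have h4 : 128 * ∫⁻ q in G, Z q ∂M ≤ 32 * M H + 4096 * M G := by
    have hZm : Measurable Z := hmeas fun ξ ζ => ∑ m, ∑ n, W m n ξ ζ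
    -- `64` is the ratio of the bound on the second moment to the least mean on `G`.
    calc 128 * ∫⁻ q in G, Z q ∂M = ∫⁻ q in G, 128 * Z q ∂M := (lintegral_const_mul _ hZm).symm
      _ ≤ ∫⁻ q in G, (Z q ^ 2 + 4096) ∂M := lintegral_mono fun q => const_mul_le_sq_add_const _
      _ = ∫⁻ q in G, Z q ^ 2 ∂M + 4096 * M G := by
          rw [lintegral_add_right _ measurable_const, setLIntegral_const]
      _ ≤ ∫⁻ q, Z q ^ 2 ∂M + 4096 * M G := by
          gcongr
          exact Measure.restrict_le_self
      _ ≤ _ := by gcongr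
  have h5 : 32 * M H + 32 * M H ≤ 4096 * M G + 32 * M H := by
    calc 32 * M H + 32 * M H = 64 * M H := by rw [← add_mul]; norm_num
      _ ≤ 64 * (2 * ∫⁻ q in G, Z q ∂M) := by gcongr
      _ = 128 * ∫⁻ q in G, Z q ∂M := by rw [← mul_assoc]; norm_num
      _ ≤ _ := h4
      _ = _ := add_comm _ _
  have h6 := ENNReal.le_of_add_le_add_right
    (ENNReal.mul_ne_top (by simp) (measure_ne_top M H)) h5
  rw [show (4096 : ℝ≥0∞) * M G = 32 * (128 * M G) by rw [← mul_assoc]; norm_num] at h6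
  exact (ENNReal.mul_le_mul_iff_right (by simp) (by simp)).1 h6

/-- The comparison for two independent chains, in terms of their laws on path space. -/
lemma measure_meeting_le [IsProbabilityMeasure P] [IsProbabilityMeasure R]
    (hP : IsPathLaw p x₀ 1 P) (hR : IsPathLaw p y₀ 1 R) {k : ℕ} (x : Fin k → S) :
    (P.prod R) {q | ∃ m n : ℕ, q.1 m = q.2 n} ≤
      128 * (P.prod R) (⋃ m, ⋃ n, goodSet x m n) := by
  have : {q : (ℕ → S) × (ℕ → S) | ∃ m n : ℕ, q.1 m = q.2 n} =
      ⋃ N : ℕ, meetingBefore S N := by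
    ext q
    simp only [meetingBefore, Set.mem_ofPred_eq, Set.mem_iUnion]
    constructor
    · rintro ⟨m, n, h⟩
      exact ⟨max m n, ⟨m, by omega⟩, ⟨n, by omega⟩, h⟩
    · rintro ⟨N, m, n, h⟩
      exact ⟨m, n, h⟩
  rw [this, Monotone.measure_iUnion]
  · exact iSup_le fun N => measure_meeting_horizon_le hP hR x N
  · rintro N N' h q ⟨m, n, hq⟩
    exact ⟨⟨m, by omega⟩, ⟨n, by omega⟩, hq⟩

end Meeting

/-! ### From path space to the given probability space -/

section Transfer

variable {Ω S : Type*} [MeasurableSpace Ω] [MeasurableSpace S] {μ : Measure Ω} {p : S → PMF S}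
  {x₀ y₀ : S}

lemma IsMarkovChain.measurable_path {X : ℕ → Ω → S} (hX : IsMarkovChain p x₀ X μ) :
    Measurable fun ω n => X n ω :=
  measurable_pi_lambda _ hX.measurable

variable [MeasurableSingletonClass S] [IsProbabilityMeasure μ]

lemma IsMarkovChain.isPathLaw {X : ℕ → Ω → S} (hX : IsMarkovChain p x₀ X μ) :
    IsPathLaw p x₀ 1 (μ.map fun ω n => X n ω) := by
  intro n s
  rw [Measure.map_apply hX.measurable_path (measurableSet_cylinder _ _), one_mul]
  change μ {ω | ∀ i ≤ n, X i ω = s i} = _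
  induction n with
  | zero =>
    rw [pathWeight, Finset.prod_range_zero, mul_one]
    split_ifs with h
    · refine (measure_congr (Filter.eventuallyEq_univ.2 ?_)).trans measure_univ
      filter_upwards [hX.initial] with ω hω i hi
      rw [Nat.le_zero.1 hi, hω, h]
    · rw [measure_eq_zero_iff_ae_notMem]
      filter_upwards [hX.initial] with ω hω h'
      exact h ((h' 0 le_rfl).symm.trans hω)
  | succ n ih => rw [hX.step, ih, pathWeight_succ]

variable [Countable S]

/-- The comparison for paths `U ω` and `V ω` distributed as two independent chains. -/
lemma measure_meeting_le_loopErasure {P R : Measure (ℕ → S)} [IsProbabilityMeasure P]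
    [IsProbabilityMeasure R] (hP : IsPathLaw p x₀ 1 P) (hR : IsPathLaw p y₀ 1 R)
    {U V : Ω → ℕ → S} (hU : Measurable U) (hV : Measurable V)
    {ν : Measure Ω} (hmap : ν.map (fun ω => (U ω, V ω)) = P.prod R) {k : ℕ} (x : Fin k → S) :
    (1 / 2 ^ 8 : ℝ≥0∞) * ν {ω | ∃ m n : ℕ, U ω m = V ω n} ≤
      ν {ω | (Set.range (loopErasure (withPrefix x (U ω))) ∩ Set.range (V ω)).Nonempty} := by
  have h1 := measure_meeting_le hP hR x
  have hUV : Measurable fun ω => (U ω, V ω) := hU.prodMk hV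
  have hG : MeasurableSet (⋃ m, ⋃ n, goodSet x m n) :=
    .iUnion fun m => .iUnion fun n => measurableSet_goodSet x m n
  have hH : MeasurableSet {q : (ℕ → S) × (ℕ → S) | ∃ m n : ℕ, q.1 m = q.2 n} := by
    simp only [Set.ofPred_exists]
    exact .iUnion fun m => .iUnion fun n => measurableSet_eq_fun
      ((measurable_pi_apply _).comp measurable_fst) ((measurable_pi_apply _).comp measurable_snd)
  rw [← hmap, Measure.map_apply hUV hH, Measure.map_apply hUV hG] at h1
  have h2 : ν ((fun ω => (U ω, V ω)) ⁻¹' ⋃ m, ⋃ n, goodSet x m n) ≤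
      ν {ω | (Set.range (loopErasure (withPrefix x (U ω))) ∩ Set.range (V ω)).Nonempty} := by
    refine measure_mono fun ω hω => ?_
    obtain ⟨m, hm⟩ := Set.mem_iUnion.1 hω
    obtain ⟨n, hn⟩ := Set.mem_iUnion.1 hm
    exact mem_range_inter_of_goodSet hn
  rw [one_div, ENNReal.inv_mul_le_iff (by simp) (by simp)]
  refine h1.trans ?_
  gcongr
  norm_num

/-- Conditionally on the first steps `s 0, …, s k` of `X`, the path of `X` after time `k` is a
chain started at `s k`, independent of `Y`. -/
lemma cond_map_shift {X Y : ℕ → Ω → S} (hX : IsMarkovChain p x₀ X μ)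
    (hY : IsMarkovChain p y₀ Y μ)
    (hindep : IndepFun (fun ω (n : ℕ) => X n ω) (fun ω (n : ℕ) => Y n ω) μ) (k : ℕ) (s : ℕ → S)
    (hB : μ {ω | ∀ i ≤ k, X i ω = s i} ≠ 0) :
    ∃ P : Measure (ℕ → S), IsProbabilityMeasure P ∧ IsPathLaw p (s k) 1 P ∧
      (μ[|{ω | ∀ i ≤ k, X i ω = s i}]).map (fun ω => (shift k (fun n => X n ω), fun n => Y n ω)) =
        P.prod (μ.map fun ω n => Y n ω) := by
  set B := {ω | ∀ i ≤ k, X i ω = s i} with hBdef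
  have hXm := hX.measurable_path
  have hYm := hY.measurable_path
  have hjoint := (indepFun_iff_map_prod_eq_prod_map_map hXm.aemeasurable hYm.aemeasurable).1 hindep
  have := Measure.isProbabilityMeasure_map (μ := μ) hXm.aemeasurable
  have := Measure.isProbabilityMeasure_map (μ := μ) hYm.aemeasurable
  set PX := μ.map fun ω n => X n ω with hPX
  set R := μ.map fun ω n => Y n ω
  have hBX : PX (cylinder k s) = μ B := Measure.map_apply hXm (measurableSet_cylinder _ _)
  have hlaw : IsPathLaw p (s k) 1 ((μ B)⁻¹ • (PX.restrict (cylinder k s)).map (shift k)) := by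
    intro n t
    rw [Measure.smul_apply, hX.isPathLaw.restrict_cylinder_map_shift k s n t, hBX, smul_eq_mul,
      ← mul_assoc, ENNReal.inv_mul_cancel hB (measure_ne_top _ _)]
  refine ⟨_, ⟨hlaw.apply_univ⟩, hlaw, ?_⟩
  have hcyl : MeasurableSet (cylinder k s ×ˢ (Set.univ : Set (ℕ → S))) :=
    (measurableSet_cylinder _ _).prod .univ
  have hpair : Measurable fun ω => ((fun n => X n ω : ℕ → S), (fun n => Y n ω : ℕ → S)) :=
    hXm.prodMk hYm
  have hB' : B = (fun ω => ((fun n => X n ω : ℕ → S), (fun n => Y n ω : ℕ → S))) ⁻¹'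
      (cylinder k s ×ˢ Set.univ) := by
    ext ω; simp [hBdef, cylinder]
  have hmap : (μ.restrict B).map (fun ω => (shift k (fun n => X n ω), fun n => Y n ω)) =
      ((PX.restrict (cylinder k s)).map (shift k)).prod R := by
    rw [show (fun ω => (shift k (fun n => X n ω), fun n => Y n ω)) =
      Prod.map (shift k) id ∘ fun ω => ((fun n => X n ω : ℕ → S), (fun n => Y n ω : ℕ → S)) from rfl,
      ← Measure.map_map ((measurable_shift k).prodMap measurable_id) hpair, hB',
      ← Measure.restrict_map hpair hcyl, hjoint, ← Measure.prod_restrict, Measure.restrict_univ,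
      ← Measure.map_prod_map _ _ (measurable_shift k) measurable_id, Measure.map_id]
  rw [ProbabilityTheory.cond, Measure.map_smul, hmap, Measure.prod_smul_left]

end Transfer

end LoopErasedWalk

theorem mainTheorem2 {Ω S : Type*} [MeasurableSpace Ω] [Countable S] [MeasurableSpace S]
    [MeasurableSingletonClass S] (μ : Measure Ω) [IsProbabilityMeasure μ]
    (p : S → PMF S) (x₀ y₀ : S) (X Y : ℕ → Ω → S)
    (hX : LoopErasedWalk.IsMarkovChain p x₀ X μ) (hY : LoopErasedWalk.IsMarkovChain p y₀ Y μ)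
    (hXtrans : LoopErasedWalk.IsTransient X μ) (hYtrans : LoopErasedWalk.IsTransient Y μ)
    (hindep : IndepFun (fun ω (n : ℕ) => X n ω) (fun ω (n : ℕ) => Y n ω) μ) :
    -- the loop-erasure of `X` against the path of `Y`
    ((1 / 2 ^ 8 : ℝ≥0∞) *
        μ {ω | (Set.range (fun m => X m ω) ∩ Set.range (fun n => Y n ω)).Nonempty} ≤
      μ {ω | (Set.range (LoopErasedWalk.loopErasure (fun m => X m ω)) ∩
        Set.range (fun n => Y n ω)).Nonempty}) ∧
    -- the same with a fixed finite prefix in front of `X`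
    (∀ (k : ℕ) (x : Fin k → S),
      (1 / 2 ^ 8 : ℝ≥0∞) * μ {ω | ∃ m n : ℕ, X m ω = Y n ω} ≤
        μ {ω | (Set.range (LoopErasedWalk.loopErasure
            (LoopErasedWalk.withPrefix x (fun m => X m ω))) ∩
          Set.range (fun n => Y n ω)).Nonempty}) ∧
    -- the same conditionally on the first `k` steps of `X`
    (∀ (k : ℕ) (x : ℕ → S) (B : Set Ω), B = {ω | ∀ i, 1 ≤ i → i ≤ k → X i ω = x i} → 0 < μ B →
      (1 / 2 ^ 8 : ℝ≥0∞) * μ[{ω | ∃ m ≥ k, ∃ n : ℕ, X m ω = Y n ω} | B] ≤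
        μ[{ω | (Set.range (LoopErasedWalk.loopErasure (fun m => X m ω)) ∩
          Set.range (fun n => Y n ω)).Nonempty} | B]) := by
  have hXm := hX.measurable_path
  have hYm := hY.measurable_path
  have hjoint := (indepFun_iff_map_prod_eq_prod_map_map hXm.aemeasurable hYm.aemeasurable).1 hindep
  have := Measure.isProbabilityMeasure_map (μ := μ) hXm.aemeasurable
  have := Measure.isProbabilityMeasure_map (μ := μ) hYm.aemeasurable
  have hprefix : ∀ (k : ℕ) (x : Fin k → S),
      (1 / 2 ^ 8 : ℝ≥0∞) * μ {ω | ∃ m n : ℕ, X m ω = Y n ω} ≤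
        μ {ω | (Set.range (LoopErasedWalk.loopErasure
            (LoopErasedWalk.withPrefix x (fun m => X m ω))) ∩
          Set.range (fun n => Y n ω)).Nonempty} := fun k x =>
    LoopErasedWalk.measure_meeting_le_loopErasure hX.isPathLaw hY.isPathLaw hXm hYm hjoint x
  refine ⟨?_, hprefix, ?_⟩
  · have h := hprefix 0 Fin.elim0
    have h1 : {ω | (Set.range (fun m => X m ω) ∩ Set.range (fun n => Y n ω)).Nonempty} =
        {ω | ∃ m n : ℕ, X m ω = Y n ω} := by
      ext ω
      constructor
      · rintro ⟨_, ⟨m, rfl⟩, n, hn⟩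
        exact ⟨m, n, hn.symm⟩
      · rintro ⟨m, n, hmn⟩
        exact ⟨_, ⟨m, rfl⟩, n, hmn.symm⟩
    rw [h1]
    have h2 : ∀ ω, LoopErasedWalk.withPrefix Fin.elim0 (fun m => X m ω) = fun m => X m ω := by
      intro ω
      ext i
      simp [LoopErasedWalk.withPrefix]
    simpa only [h2] using h
  · intro k x B hB hpos
    -- The initial state is added to the prescribed steps; this changes `B` by a null set.
    set s : ℕ → S := fun i => if i = 0 then x₀ else x i with hs
    set B' := {ω | ∀ i ≤ k, X i ω = s i} with hB'
    have hBB' : B =ᵐ[μ] B' := by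
      filter_upwards [hX.initial] with ω hω
      refine propext ?_
      change ω ∈ B ↔ ω ∈ B'
      rw [hB]
      constructor
      · intro h i hi
        rcases Nat.eq_zero_or_pos i with rfl | h0
        · simpa [hs] using hω
        · rw [h i h0 hi]
          simp [hs, h0.ne']
      · intro h i h0 hi
        rw [h i hi]
        simp [hs, Nat.one_le_iff_ne_zero.1 h0]
    have hcond : μ[|B] = μ[|B'] := by
      rw [ProbabilityTheory.cond, ProbabilityTheory.cond, measure_congr hBB',
        Measure.restrict_congr_set hBB']
    rw [measure_congr hBB'] at hpos
    rw [hcond]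
    obtain ⟨P, hPprob, hP, hmap⟩ := LoopErasedWalk.cond_map_shift hX hY hindep k s hpos.ne'
    have h := LoopErasedWalk.measure_meeting_le_loopErasure hP hY.isPathLaw
      ((LoopErasedWalk.measurable_shift k).comp hXm) hYm hmap (fun i : Fin k => s i)
    have h1 : {ω | ∃ m ≥ k, ∃ n : ℕ, X m ω = Y n ω} =
        {ω | ∃ m n : ℕ, LoopErasedWalk.shift k (fun n => X n ω) m = Y n ω} := by
      ext ω
      constructor
      · rintro ⟨m, hm, n, hn⟩
        exact ⟨m - k, n, by simpa [LoopErasedWalk.shift, Nat.add_sub_cancel' hm] using hn⟩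
      · rintro ⟨m, n, hn⟩
        exact ⟨k + m, Nat.le_add_right _ _, n, hn⟩
    rw [h1]
    refine h.trans (measure_mono_ae ?_)
    have hB'm : MeasurableSet B' := hXm (LoopErasedWalk.measurableSet_cylinder k s)
    filter_upwards [ae_cond_mem hB'm] with ω hω
    have h2 : LoopErasedWalk.withPrefix (fun i : Fin k => s i)
        (LoopErasedWalk.shift k fun n => X n ω) = fun m => X m ω := by
      ext i
      simp only [LoopErasedWalk.withPrefix, LoopErasedWalk.shift]
      split_ifs with hi
      · exact (hω i hi.le).symm
      · rw [Nat.add_sub_cancel' (not_lt.1 hi)]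
    intro hn
    change (Set.range (LoopErasedWalk.loopErasure (LoopErasedWalk.withPrefix
      (fun i : Fin k => s i) (LoopErasedWalk.shift k fun n => X n ω))) ∩
        Set.range (fun n => Y n ω)).Nonempty at hn
    rwa [h2] at hn
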